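/- **Lattice excision.** A combinatorial $2$-complex consists of a graph (vertices, and edges $e$ with a start vertex and a fixed-point-free inversion $e\mapsto e^{-1}$) together with faces $\sigma$, with a fixed-point-free inversion; each face has a boundary circle $X^\sigma$ (an oriented cycle with $n\ge 1$ edges, or a single vertex) and an attaching map $\alpha_\sigma$ of this circle to the graph sending edges to edges, and $\sigma^{-1}$ is attached by the same circle run backwards. A dimension preserving map $f:Y\to X$ sends vertices, edges, faces to vertices, edges, faces, compatibly with start vertices and inverses, and comes with orientation preserving isomorphisms (rotations) $\varepsilon(f,\sigma):Y^\sigma\to X^{f(\sigma)}$ with $f\alpha_\sigma=\alpha_{f(\sigma)}\varepsilon(f,\sigma)$. It is a *covering* if for each vertex $u$ of $Y$ it is a bijection from the edges starting at $u$ to those starting at $f(u)$, and for each face $\tau$ of $X$ the maps $\varepsilon(f,\sigma)$ give a bijection $\bigsqcup_{f(\sigma)=\tau}\alpha_\sigma^{-1}(u)\to\alpha_\tau^{-1}(f(u))$. It is *Galois* (via $v$) if for each closed path at the vertex $v$ of $X$ the lifts to the vertices of the fiber $f^{-1}(v)$ are either all closed or all non-closed. For a covering $f:Y_u\to X_v$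 of connected pointed $2$-complexes, let $\mathcal L(Y_u,X_v)$ be the set of pairs of coverings $Y_u\to W_x\to X_v$ of connected pointed complexes with composition $f$, up to isomorphisms of $W_x$ commuting with the maps from $Y$ and to $X$, ordered by $W_x\le W'_{x'}$ if there is a covering $W'_{x'}\to W_x$ commuting with the maps from $Y$ and to $X$. For a disjoint family of connected subcomplexes $A_i$ of $X$, let $X/A_i$ be the quotient complex in which each $A_i$ is squashed to a vertex of its own (the boundary circles of the remaining faces being collapsed along the parts attached into the $A_i$). Let $f:Y_u\to X_v$ be a covering of connected pointed $2$-complexes and let $Z\subset X$ be a connected, simply connected subcomplex containing $v$. Let $f^{-1}(Z)=\bigcup_{i\in I} Z_i$ with the $Z_i$ the connected components, and let $q:X\to X/Z$ and $q':Y\to Y/Z_i$ be the quotient maps. Then $Y/Z_i$ and $X/Z$ are connected, there is a covering $f':(Y/Z_i)_{q'(u)}\to (X/Z)_{q(v)}$ with $f'q'=qf$, the posets $\mathcal L(Y_u,X_v)$ and $\mathcal L\bigl((Y/Z_i)_{q'(u)},(X/Z)_{q(v)}\bigr)$ (the latter formed with respect to $f'$) are lattices, and there is an isomorphism of lattices $$\mathcal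 L(Y_u,X_v)\;\stackrel{\cong}{\longrightarrow}\;\mathcal L\bigl((Y/Z_i)_{q'(u)},(X/Z)_{q(v)}\bigr)$$ that sends the equivalence class of $Y_u\to W_x\stackrel{g}{\to}X_v$ to the equivalence class of $(Y/Z_i)_{q'(u)}\to (W/Z'_j)_{q''(x)}\stackrel{g'}{\to}(X/Z)_{q(v)}$, where $g^{-1}(Z)=\bigcup_{j\in J} Z'_j$ with the $Z'_j$ the connected components, $q'':W\to W/Z'_j$ is the quotient map, and the two maps are the coverings induced by $Y\to W$ and by $g$ (they commute with the quotient maps). Moreover $g:W_x\to X_v$ is Galois if and only if $g':(W/Z'_j)_{q''(x)}\to(X/Z)_{q(v)}$ is Galois. -/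

import Mathlib

universe u

/-- `IsWalk s t a l b`: the list of edges `l` is a path from `a` to `b`, where `s`, `t` give the
start and terminal vertex of an edge. The empty list is the trivial path at `a = b`. -/
def IsWalk {V E : Type u} (s t : E → V) : V → List E → V → Prop
  | a, [], b => a = b
  | a, e :: l, b => s e = a ∧ IsWalk s t (t e) l b

theorem IsWalk.append {V E : Type u} {s t : E → V} {a b c : V} {l m : List E}
    (hl : IsWalk s t a l b) (hm : IsWalk s t b m c) : IsWalk s t a (l ++ m) c := by
  induction l generalizing a with
  | nil => cases hl; exact hm
  | cons e l ih => exact ⟨hl.1, ih hl.2⟩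

theorem IsWalk.reverse {V E : Type u} {s : E → V} {i : E → E} (hi : ∀ e, i (i e) = e)
    {a b : V} {l : List E} (hl : IsWalk s (fun e => s (i e)) a l b) :
    IsWalk s (fun e => s (i e)) b (l.map i).reverse a := by
  induction l generalizing a with
  | nil => exact Eq.symm hl
  | cons e l ih =>
    rw [List.map_cons, List.reverse_cons]
    refine (ih hl.2).append ⟨rfl, ?_⟩
    change s (i (i e)) = a
    rw [hi]
    exact hl.1

/-- A combinatorial 2-complex: vertices `V`, edges `E` with fixed-point-free inversion `einv` and
start vertex `src`, and faces `F` with fixed-point-free inversion `finv`.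

The boundary of a face `σ` is a 1-sphere with a dimension preserving attaching map to the
1-skeleton. The 1-sphere is the cycle with `n` consecutively labelled vertices `v₀, …, vₙ₋₁` and
edges `eᵢ` from `vᵢ` to `vᵢ₊₁` (its standard orientation), or a single vertex `v₀` if `n = 0`.
The attaching map is recorded by the image `base σ` of `v₀` and the list `word σ` of the images
of `e₀, …, eₙ₋₁`, a closed path at `base σ`. The face `finv σ` has the same closed path run
backwards. -/
structure TwoComplex : Type (u + 1) where
  V : Type u
  E : Type u
  F : Type u
  src : E → V
  einv : E → E
  einv_einv : ∀ e, einv (einv e) = e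
  einv_ne : ∀ e, einv e ≠ e
  finv : F → F
  finv_finv : ∀ σ, finv (finv σ) = σ
  finv_ne : ∀ σ, finv σ ≠ σ
  base : F → V
  word : F → List E
  word_closed : ∀ σ, IsWalk src (fun e => src (einv e)) (base σ) (word σ) (base σ)
  base_finv : ∀ σ, base (finv σ) = base σ
  word_finv : ∀ σ, word (finv σ) = ((word σ).map einv).reverse

namespace TwoComplex

/-- The terminal vertex of an edge. -/
def tgt (X : TwoComplex.{u}) (e : X.E) : X.V := X.src (X.einv e)

/-- `l` is a path in `X` from `a` to `b`. -/
def Path (X : TwoComplex.{u}) (a : X.V) (l : List X.E) (b : X.V) : Prop :=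
  IsWalk X.src X.tgt a l b

/-- `X` is non-empty and any two vertices are joined by a path. -/
def Connected (X : TwoComplex.{u}) : Prop :=
  Nonempty X.V ∧ ∀ a b : X.V, ∃ l, X.Path a l b

/-- The number of vertices of the boundary 1-sphere of `σ`; its vertices are the `vᵢ` with
`i < X.size σ`. -/
def size (X : TwoComplex.{u}) (σ : X.F) : ℕ := max 1 (X.word σ).length

/-- The image of the vertex `vᵢ` of the boundary 1-sphere of `σ` under the attaching map
(meaningful for `i < X.size σ`). -/
def vertexAt (X : TwoComplex.{u}) (σ : X.F) (i : ℕ) : X.V :=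
  ((X.word σ)[i]?).elim (X.base σ) X.src

/-- The cells of `X`. -/
abbrev Cell (X : TwoComplex.{u}) : Type u := X.V ⊕ X.E ⊕ X.F

/-- A dimension preserving map of 2-complexes. For each face `σ` it includes an orientation
preserving isomorphism from the boundary sphere of `σ` to that of the image face; this is a
rotation `vᵢ ↦ vᵢ₊ₖ`, recorded by `k = rot σ`, and it commutes with the attaching maps. Since the
boundary of `σ⁻¹` is that of `σ` traversed backwards, the rotation for `σ⁻¹` is the inverse one. -/
@[ext]
structure Hom (Y X : TwoComplex.{u}) where
  onV : Y.V → X.V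
  onE : Y.E → X.E
  onF : Y.F → X.F
  rot : Y.F → ℕ
  onV_src : ∀ e, onV (Y.src e) = X.src (onE e)
  onE_einv : ∀ e, onE (Y.einv e) = X.einv (onE e)
  onF_finv : ∀ σ, onF (Y.finv σ) = X.finv (onF σ)
  rot_lt : ∀ σ, rot σ < X.size (onF σ)
  onV_base : ∀ σ, onV (Y.base σ) = X.vertexAt (onF σ) (rot σ)
  map_word : ∀ σ, (Y.word σ).map onE = (X.word (onF σ)).rotate (rot σ)
  rot_finv : ∀ σ, (rot σ + rot (Y.finv σ)) % X.size (onF σ) = 0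

theorem size_pos (X : TwoComplex.{u}) (σ : X.F) : 0 < X.size σ :=
  lt_of_lt_of_le Nat.one_pos (le_max_left _ _)

theorem size_finv (X : TwoComplex.{u}) (σ : X.F) : X.size (X.finv σ) = X.size σ := by
  simp [size, X.word_finv]

namespace Hom

variable {X Y W : TwoComplex.{u}}

theorem length_word (f : Hom Y X) (σ : Y.F) :
    (X.word (f.onF σ)).length = (Y.word σ).length := by
  simpa using (congrArg List.length (f.map_word σ)).symm

theorem size_onF (f : Hom Y X) (σ : Y.F) : X.size (f.onF σ) = Y.size σ := by
  rw [size, size, f.length_word]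

/-- The isomorphism of boundary spheres `ε(f, σ)` on (labels of) vertices. -/
def eps (f : Hom Y X) (σ : Y.F) (i : ℕ) : ℕ := (i + f.rot σ) % X.size (f.onF σ)

theorem onV_vertexAt (f : Hom Y X) (σ : Y.F) (i : ℕ) (hi : i < Y.size σ) :
    f.onV (Y.vertexAt σ i) = X.vertexAt (f.onF σ) (f.eps σ i) := by
  have hs := f.size_onF σ
  have hl := f.length_word σ
  rcases Nat.eq_zero_or_pos (Y.word σ).length with h0 | h0
  · have h0' : Y.word σ = [] := List.length_eq_zero_iff.1 h0
    have h1 : X.word (f.onF σ) = [] := List.length_eq_zero_iff.1 (hl.trans h0)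
    have := f.onV_base σ
    simp only [vertexAt, h1] at this
    simp only [vertexAt, h0', h1]
    simpa using this
  · have hsz : X.size (f.onF σ) = (X.word (f.onF σ)).length := by
      rw [size, hl]; exact max_eq_right h0
    have hiY : i < (Y.word σ).length := by
      rw [← hl, ← hsz, hs]; exact hi
    have hj : f.eps σ i < (X.word (f.onF σ)).length := by
      rw [← hsz]; exact Nat.mod_lt _ (X.size_pos _)
    have key : f.onE ((Y.word σ)[i]) = (X.word (f.onF σ))[f.eps σ i] := by
      have h2 : ((Y.word σ).map f.onE)[i]? = ((X.word (f.onF σ)).rotate (f.rot σ))[i]? := by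
        rw [f.map_word]
      rw [List.getElem?_map, List.getElem?_eq_getElem hiY,
        List.getElem?_eq_getElem (by rw [List.length_rotate, hl]; exact hiY),
        List.getElem_rotate] at h2
      simp only [Option.map_some, Option.some.injEq] at h2
      rw [h2]
      simp only [eps, hsz]
    simp only [vertexAt, List.getElem?_eq_getElem hiY, List.getElem?_eq_getElem hj,
      Option.elim_some]
    rw [f.onV_src, key]

/-- The identity map. -/
protected def id (X : TwoComplex.{u}) : Hom X X where
  onV := _root_.id
  onE := _root_.id
  onF := _root_.id
  rot _ := 0
  onV_src _ := rfl
  onE_einv _ := rfl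
  onF_finv _ := rfl
  rot_lt σ := X.size_pos σ
  onV_base σ := by
    have h := X.word_closed σ
    cases hw : X.word σ with
    | nil => simp [vertexAt, hw]
    | cons e l => rw [hw] at h; simp [vertexAt, hw, h.1]
  map_word σ := by simp
  rot_finv σ := by simp

/-- The composition `Y → W → X`; the isomorphisms of boundary spheres are composed. -/
def comp (h : Hom W X) (g : Hom Y W) : Hom Y X where
  onV := h.onV ∘ g.onV
  onE := h.onE ∘ g.onE
  onF := h.onF ∘ g.onF
  rot σ := h.eps (g.onF σ) (g.rot σ)
  onV_src e := by simp [g.onV_src, h.onV_src]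
  onE_einv e := by simp [g.onE_einv, h.onE_einv]
  onF_finv σ := by simp [g.onF_finv, h.onF_finv]
  rot_lt σ := Nat.mod_lt _ (X.size_pos _)
  onV_base σ := by
    simp only [Function.comp_apply]
    rw [g.onV_base, h.onV_vertexAt _ _ (g.rot_lt σ)]
  map_word σ := by
    rw [← List.map_map, g.map_word, List.map_rotate, h.map_word, List.rotate_rotate]
    simp only [Function.comp_apply, eps]
    rcases Nat.eq_zero_or_pos (X.word (h.onF (g.onF σ))).length with h0 | h0
    · rw [List.length_eq_zero_iff.1 h0]; simp
    · rw [size, max_eq_right h0, List.rotate_mod, add_comm]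
  rot_finv σ := by
    have h1 := g.rot_finv σ
    have h2 := h.rot_finv (g.onF σ)
    rw [← h.size_onF] at h1
    simp only [Function.comp_apply, eps, g.onF_finv, h.onF_finv, size_finv]
    rw [← Nat.add_mod]
    have : g.rot σ + h.rot (g.onF σ) + (g.rot (Y.finv σ) + h.rot (W.finv (g.onF σ)))
        = (g.rot σ + g.rot (Y.finv σ)) + (h.rot (g.onF σ) + h.rot (W.finv (g.onF σ))) := by ring
    rw [this, Nat.add_mod, h1, h2]
    simp

/-- A map is an isomorphism if it is bijective on vertices, edges and faces. -/
def IsIso (f : Hom Y X) : Prop :=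
  Function.Bijective f.onV ∧ Function.Bijective f.onE ∧ Function.Bijective f.onF

/-- A covering: at every vertex `u` of `Y` the map is a bijection from the edges starting at `u`
to the edges starting at `f u`, and for every face `τ` of `X` the union of the sphere isomorphisms
`ε(f, σ)` over the faces `σ` above `τ` is a bijection from the appearances `(σ, i)` of `u` in the
boundaries of these faces to the appearances of `f u` in the boundary of `τ`. -/
def IsCovering (f : Hom Y X) : Prop :=
  (∀ u : Y.V, Set.BijOn f.onE {e | Y.src e = u} {e | X.src e = f.onV u}) ∧
  ∀ (u : Y.V) (τ : X.F),
    Set.BijOn (fun c : Y.F × ℕ => f.eps c.1 c.2)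
      {c | f.onF c.1 = τ ∧ c.2 < Y.size c.1 ∧ Y.vertexAt c.1 c.2 = u}
      {j | j < X.size τ ∧ X.vertexAt τ j = f.onV u}

/-- A covering is Galois (via the vertex `v`) if for every closed path `γ` at `v`, the lifts of
`γ` to the vertices of the fiber of `v` are either all closed or all non-closed. -/
def IsGalois (f : Hom Y X) (v : X.V) : Prop :=
  f.IsCovering ∧
  ∀ γ : List X.E, X.Path v γ v →
    ∀ (u₁ w₁ u₂ w₂ : Y.V) (μ₁ μ₂ : List Y.E),
      f.onV u₁ = v → Y.Path u₁ μ₁ w₁ → μ₁.map f.onE = γ →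
      f.onV u₂ = v → Y.Path u₂ μ₂ w₂ → μ₂.map f.onE = γ →
      (w₁ = u₁ ↔ w₂ = u₂)

/-- The induced map on cells. -/
def onCell (f : Hom Y X) : Y.Cell → X.Cell :=
  Sum.map f.onV (Sum.map f.onE f.onF)

end Hom

/-- A subcomplex of `X`. -/
structure Subcomplex (X : TwoComplex.{u}) where
  V : Set X.V
  E : Set X.E
  F : Set X.F
  src_mem : ∀ e ∈ E, X.src e ∈ V
  einv_mem : ∀ e ∈ E, X.einv e ∈ E
  finv_mem : ∀ σ ∈ F, X.finv σ ∈ F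
  base_mem : ∀ σ ∈ F, X.base σ ∈ V
  word_mem : ∀ σ ∈ F, ∀ e ∈ X.word σ, e ∈ E

namespace Subcomplex

variable {X Y : TwoComplex.{u}}

theorem not_einv_mem (A : Subcomplex X) {e : X.E} (he : e ∉ A.E) : X.einv e ∉ A.E :=
  fun h => he (by simpa [X.einv_einv] using A.einv_mem _ h)

theorem not_finv_mem (A : Subcomplex X) {σ : X.F} (hσ : σ ∉ A.F) : X.finv σ ∉ A.F :=
  fun h => hσ (by simpa [X.finv_finv] using A.finv_mem _ h)

/-- `l` is a path from `a` to `b` all of whose edges lie in `A`. -/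
def PathIn (A : Subcomplex X) (a : X.V) (l : List X.E) (b : X.V) : Prop :=
  X.Path a l b ∧ ∀ e ∈ l, e ∈ A.E

/-- `A` is non-empty and any two of its vertices are joined by a path in `A`. -/
def Connected (A : Subcomplex X) : Prop :=
  A.V.Nonempty ∧ ∀ a ∈ A.V, ∀ b ∈ A.V, ∃ l, A.PathIn a l b

/-- An elementary homotopy inside `A` between paths in `A` from `a` to `b`: the second path is
obtained from the first by inserting a spur `e e⁻¹` or the full boundary of a face of `A`, read
from any of its vertices. -/
def ElemHomotopy (A : Subcomplex X) (a b : X.V) (l l' : List X.E) : Prop :=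
  A.PathIn a l b ∧ A.PathIn a l' b ∧
  ∃ p q r : List X.E, l = p ++ q ∧ l' = p ++ r ++ q ∧
    ((∃ e ∈ A.E, r = [e, X.einv e]) ∨ ∃ σ ∈ A.F, ∃ k : ℕ, r = (X.word σ).rotate k)

/-- Homotopy, inside `A`, of paths from `a` to `b`: the equivalence relation generated by
elementary homotopies. -/
def Homotopic (A : Subcomplex X) (a b : X.V) : List X.E → List X.E → Prop :=
  Relation.EqvGen (A.ElemHomotopy a b)

/-- Every closed path in `A` is homotopic in `A` to the trivial path. -/
def SimplyConnected (A : Subcomplex X) : Prop :=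
  ∀ a ∈ A.V, ∀ l, A.PathIn a l a → A.Homotopic a a l []

/-- The relation of lying in the same connected component of `A` (extended by equality for
vertices outside `A`). -/
def setoid (A : Subcomplex X) : Setoid X.V where
  r a b := ∃ l, A.PathIn a l b
  iseqv :=
    { refl := fun _ => ⟨[], rfl, by simp⟩
      symm := by
        rintro a b ⟨l, hl, hA⟩
        refine ⟨(l.map X.einv).reverse, IsWalk.reverse X.einv_einv hl, fun e he => ?_⟩
        obtain ⟨e', he', rfl⟩ := List.mem_map.1 (List.mem_reverse.1 he)
        exact A.einv_mem _ (hA _ he')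
      trans := by
        rintro a b c ⟨l, hl, hA⟩ ⟨m, hm, hB⟩
        refine ⟨l ++ m, hl.append hm, fun e he => ?_⟩
        rcases List.mem_append.1 he with h | h
        · exact hA _ h
        · exact hB _ h }

open Classical in
/-- Delete the edges lying in `A` from a list of edges. -/
noncomputable def trim (A : Subcomplex X) (l : List X.E) : List {e : X.E // e ∉ A.E} :=
  l.filterMap fun e => if h : e ∈ A.E then none else some ⟨e, h⟩

theorem trim_cons_mem (A : Subcomplex X) {e : X.E} (h : e ∈ A.E) (l : List X.E) :
    A.trim (e :: l) = A.trim l := by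
  simp [trim, h]

theorem trim_cons_not_mem (A : Subcomplex X) {e : X.E} (h : e ∉ A.E) (l : List X.E) :
    A.trim (e :: l) = ⟨e, h⟩ :: A.trim l := by
  simp [trim, h]

theorem trim_append (A : Subcomplex X) (l m : List X.E) :
    A.trim (l ++ m) = A.trim l ++ A.trim m :=
  List.filterMap_append

theorem trim_walk (A : Subcomplex X) {a b : X.V} {l : List X.E} (hl : X.Path a l b) :
    IsWalk (fun e : {e : X.E // e ∉ A.E} => (Quotient.mk A.setoid (X.src e.1)))
      (fun e => Quotient.mk A.setoid (X.src (X.einv e.1)))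
      (Quotient.mk A.setoid a) (A.trim l) (Quotient.mk A.setoid b) := by
  induction l generalizing a with
  | nil => exact congrArg _ hl
  | cons e l ih =>
    by_cases h : e ∈ A.E
    · rw [A.trim_cons_mem h]
      have hq : Quotient.mk A.setoid a = Quotient.mk A.setoid (X.tgt e) :=
        Quotient.sound ⟨[e], ⟨hl.1, rfl⟩, by simpa using h⟩
      rw [hq]
      exact ih hl.2
    · rw [A.trim_cons_not_mem h]
      exact ⟨congrArg _ hl.1, ih hl.2⟩

theorem trim_reverse (A : Subcomplex X) (l : List X.E) :
    A.trim (l.map X.einv).reverse =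
      ((A.trim l).map fun e => ⟨X.einv e.1, A.not_einv_mem e.2⟩).reverse := by
  induction l with
  | nil => rfl
  | cons e l ih =>
    rw [List.map_cons, List.reverse_cons, trim_append, ih]
    by_cases h : e ∈ A.E
    · rw [A.trim_cons_mem h, A.trim_cons_mem (A.einv_mem _ h)]
      simp [trim]
    · rw [A.trim_cons_not_mem h, A.trim_cons_not_mem (A.not_einv_mem h)]
      simp [trim]

/-- The quotient of `X` in which each connected component of the subcomplex `A` is squashed to a
vertex of its own and the other cells are unaffected. The boundary sphere of a face outside `A` is
collapsed along the parts that attach into `A`. For connected `A` this is the quotient `X/A`. -/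
noncomputable def collapse (A : Subcomplex X) : TwoComplex.{u} where
  V := Quotient A.setoid
  E := {e : X.E // e ∉ A.E}
  F := {σ : X.F // σ ∉ A.F}
  src e := Quotient.mk A.setoid (X.src e.1)
  einv e := ⟨X.einv e.1, A.not_einv_mem e.2⟩
  einv_einv e := Subtype.ext (X.einv_einv e.1)
  einv_ne e h := X.einv_ne e.1 (congrArg Subtype.val h)
  finv σ := ⟨X.finv σ.1, A.not_finv_mem σ.2⟩
  finv_finv σ := Subtype.ext (X.finv_finv σ.1)
  finv_ne σ h := X.finv_ne σ.1 (congrArg Subtype.val h)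
  base σ := Quotient.mk A.setoid (X.base σ.1)
  word σ := A.trim (X.word σ.1)
  word_closed σ := A.trim_walk (X.word_closed σ.1)
  base_finv σ := by rw [X.base_finv]
  word_finv σ := by rw [X.word_finv, A.trim_reverse]

/-- The quotient map on vertices. -/
def projV (A : Subcomplex X) (a : X.V) : A.collapse.V := Quotient.mk A.setoid a

open Classical in
/-- The quotient map on cells: a cell of `A` goes to the vertex given by its component. -/
noncomputable def proj (A : Subcomplex X) : X.Cell → A.collapse.Cell
  | .inl a => .inl (A.projV a)
  | .inr (.inl e) => if h : e ∈ A.E then .inl (A.projV (X.src e)) else .inr (.inl ⟨e, h⟩)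
  | .inr (.inr σ) => if h : σ ∈ A.F then .inl (A.projV (X.base σ)) else .inr (.inr ⟨σ, h⟩)

/-- The quotient map from the boundary sphere of a face outside `A` to its collapsed boundary
sphere, on (labels of) vertices: `vᵢ ↦ vⱼ`, where `j` is the number of edges among
`e₀, …, eᵢ₋₁` that are not collapsed, read modulo the size of the collapsed sphere. -/
noncomputable def projPos (A : Subcomplex X) (σ : A.collapse.F) (i : ℕ) : ℕ :=
  (A.trim ((X.word σ.1).take i)).length % A.collapse.size σ

/-- The preimage of a subcomplex. -/
def comap (A : Subcomplex X) (f : Hom Y X) : Subcomplex Y where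
  V := f.onV ⁻¹' A.V
  E := f.onE ⁻¹' A.E
  F := f.onF ⁻¹' A.F
  src_mem e he := by
    change f.onV (Y.src e) ∈ A.V
    rw [f.onV_src]; exact A.src_mem _ he
  einv_mem e he := by
    change f.onE (Y.einv e) ∈ A.E
    rw [f.onE_einv]; exact A.einv_mem _ he
  finv_mem σ hσ := by
    change f.onF (Y.finv σ) ∈ A.F
    rw [f.onF_finv]; exact A.finv_mem _ hσ
  base_mem σ hσ := by
    change f.onV (Y.base σ) ∈ A.V
    rw [f.onV_base, vertexAt]
    cases h : (X.word (f.onF σ))[f.rot σ]? with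
    | none => exact A.base_mem _ hσ
    | some e => exact A.src_mem _ (A.word_mem _ hσ _ (List.mem_of_getElem? h))
  word_mem σ hσ e he := by
    have h : f.onE e ∈ (Y.word σ).map f.onE := List.mem_map_of_mem he
    rw [f.map_word, List.mem_rotate] at h
    exact A.word_mem _ hσ _ h

end Subcomplex

/-- `f' : Y/B → X/A` is induced by `f : Y → X`: the square formed by `f`, `f'` and the two quotient
maps commutes, on cells and on the boundary spheres of faces not squashed to a vertex. -/
def IsInduced {X Y : TwoComplex.{u}} (A : Subcomplex X) (B : Subcomplex Y) (f : Hom Y X)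
    (f' : Hom B.collapse A.collapse) : Prop :=
  (∀ c : Y.Cell, f'.onCell (B.proj c) = A.proj (f.onCell c)) ∧
  ∀ (σ : Y.F) (hB : σ ∉ B.F) (hA : f.onF σ ∉ A.F) (i : ℕ), i < Y.size σ →
    f'.eps ⟨σ, hB⟩ (B.projPos ⟨σ, hB⟩ i) = A.projPos ⟨f.onF σ, hA⟩ (f.eps σ i)

/-- A connected pointed covering `Y_u → W_pt → X_v` intermediate to `f : Y_u → X_v`. -/
structure Intermediate {X Y : TwoComplex.{u}} (f : Hom Y X) (u : Y.V) (v : X.V) :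
    Type (u + 1) where
  W : TwoComplex.{u}
  conn : W.Connected
  pt : W.V
  g : Hom Y W
  h : Hom W X
  g_cov : g.IsCovering
  h_cov : h.IsCovering
  comp_eq : h.comp g = f
  g_pt : g.onV u = pt
  h_pt : h.onV pt = v

namespace Hom

variable {X Y W : TwoComplex.{u}}

theorem id_comp (f : Hom Y X) : (Hom.id X).comp f = f := by
  ext σ
  · rfl
  · rfl
  · rfl
  · exact Nat.mod_eq_of_lt (f.rot_lt σ)

theorem comp_id (f : Hom Y X) : f.comp (Hom.id Y) = f := by
  ext σ
  · rfl
  · rfl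
  · rfl
  · change (0 + f.rot σ) % _ = _
    rw [zero_add]
    exact Nat.mod_eq_of_lt (f.rot_lt σ)

theorem comp_assoc {T : TwoComplex.{u}} (f : Hom W X) (g : Hom Y W) (h : Hom T Y) :
    (f.comp g).comp h = f.comp (g.comp h) := by
  ext σ
  · rfl
  · rfl
  · rfl
  · have hs := f.size_onF (g.onF (h.onF σ))
    simp only [comp, eps, Function.comp_apply]
    rw [← hs, Nat.add_mod_mod, Nat.mod_add_mod, add_assoc]

theorem IsIso.comp {f : Hom W X} {g : Hom Y W} (hf : f.IsIso) (hg : g.IsIso) :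
    (f.comp g).IsIso :=
  ⟨hf.1.comp hg.1, hf.2.1.comp hg.2.1, hf.2.2.comp hg.2.2⟩

/-- The inverse of an isomorphism is an isomorphism. -/
theorem IsIso.exists_inv {f : Hom Y X} (hf : f.IsIso) :
    ∃ k : Hom X Y, k.IsIso ∧ k.comp f = Hom.id Y ∧ f.comp k = Hom.id X := by
  let a := Equiv.ofBijective f.onV hf.1
  let b := Equiv.ofBijective f.onE hf.2.1
  let c := Equiv.ofBijective f.onF hf.2.2
  have ha : ∀ x, f.onV (a.symm x) = x := a.apply_symm_apply
  have hb : ∀ x, f.onE (b.symm x) = x := b.apply_symm_apply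
  have hc : ∀ x, f.onF (c.symm x) = x := c.apply_symm_apply
  have ha' : ∀ x, a.symm (f.onV x) = x := a.symm_apply_apply
  have hb' : ∀ x, b.symm (f.onE x) = x := b.symm_apply_apply
  have hc' : ∀ x, c.symm (f.onF x) = x := c.symm_apply_apply
  have hsize : ∀ σ, Y.size (c.symm σ) = X.size σ := fun σ => by
    rw [← f.size_onF, hc]
  have hrot : ∀ σ, f.rot (c.symm σ) < X.size σ := fun σ => by
    simpa [hc] using f.rot_lt (c.symm σ)
  have hepsr : ∀ σ, f.eps (c.symm σ) ((X.size σ - f.rot (c.symm σ)) % X.size σ) = 0 := fun σ => by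
    have := hrot σ
    rw [eps, hc, Nat.mod_add_mod, Nat.sub_add_cancel this.le, Nat.mod_self]
  have hfinv : ∀ σ, c.symm (X.finv σ) = Y.finv (c.symm σ) := fun σ => hf.2.2.1 (by
    rw [hc, f.onF_finv, hc])
  let k : Hom X Y :=
    { onV := a.symm
      onE := b.symm
      onF := c.symm
      rot := fun σ => (X.size σ - f.rot (c.symm σ)) % X.size σ
      onV_src := fun e => hf.1.1 (by rw [ha, f.onV_src, hb])
      onE_einv := fun e => hf.2.1.1 (by rw [hb, f.onE_einv, hb])
      onF_finv := hfinv
      rot_lt := fun σ => by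
        rw [hsize]; exact Nat.mod_lt _ (X.size_pos σ)
      onV_base := fun σ => hf.1.1 (by
        rw [ha, f.onV_vertexAt _ _ (by rw [hsize]; exact Nat.mod_lt _ (X.size_pos σ)), hepsr, hc]
        exact (Hom.id X).onV_base σ)
      map_word := fun σ => by
        have h1 := f.map_word (c.symm σ)
        rw [hc] at h1
        have h2 : X.word σ = ((Y.word (c.symm σ)).map f.onE).rotate
            ((X.size σ - f.rot (c.symm σ)) % X.size σ) := by
          rw [h1, List.rotate_rotate]
          rcases Nat.eq_zero_or_pos (X.word σ).length with h0 | h0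
          · rw [List.length_eq_zero_iff.1 h0]; simp
          · have hsz : X.size σ = (X.word σ).length := max_eq_right h0
            rw [← List.rotate_mod, ← hsz, Nat.add_mod_mod, Nat.add_sub_cancel' (hrot σ).le,
              Nat.mod_self, List.rotate_zero]
        conv_lhs => rw [h2]
        rw [List.map_rotate, List.map_map]
        have : (⇑b.symm ∘ f.onE) = _root_.id := funext hb'
        rw [this, List.map_id]
      rot_finv := fun σ => by
        have h1 := f.rot_finv (c.symm σ)
        rw [hc, ← hfinv] at h1
        have h2 := hrot σ
        have h3 := hrot (X.finv σ)
        rw [size_finv] at h3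
        rw [hsize, size_finv, ← Nat.add_mod]
        obtain ⟨m, hm⟩ := Nat.dvd_of_mod_eq_zero h1
        have h4 : X.size σ - f.rot (c.symm σ) + (X.size σ - f.rot (c.symm (X.finv σ)))
            + (f.rot (c.symm σ) + f.rot (c.symm (X.finv σ))) = 2 * X.size σ := by omega
        rw [hm] at h4
        have h5 : X.size σ ∣ X.size σ - f.rot (c.symm σ) +
            (X.size σ - f.rot (c.symm (X.finv σ))) :=
          (Nat.dvd_add_left (Dvd.intro _ rfl)).1 (h4 ▸ Dvd.intro_left _ rfl)
        exact Nat.mod_eq_zero_of_dvd h5 }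
  refine ⟨k, ⟨a.symm.bijective, b.symm.bijective, c.symm.bijective⟩, ?_, ?_⟩
  · ext σ
    · exact ha' _
    · exact hb' _
    · exact hc' _
    · change (f.rot σ + (X.size (f.onF σ) - f.rot (c.symm (f.onF σ))) % X.size (f.onF σ)) %
        Y.size (c.symm (f.onF σ)) = 0
      rw [hsize, hc', Nat.add_mod_mod, Nat.add_sub_cancel' (f.rot_lt σ).le, Nat.mod_self]
  · ext σ
    · exact ha _
    · exact hb _
    · exact hc _
    · exact hepsr σ

end Hom

namespace Intermediate

variable {X Y : TwoComplex.{u}} {f : Hom Y X} {u : Y.V} {v : X.V}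

/-- Intermediate coverings are equivalent if there is an isomorphism of the middle complexes
commuting with the maps from `Y` and to `X` (it then preserves the base points). -/
def Equivalent (I J : Intermediate f u v) : Prop :=
  ∃ i : Hom I.W J.W, i.IsIso ∧ i.onV I.pt = J.pt ∧ i.comp I.g = J.g ∧ J.h.comp i = I.h

instance equivSetoid (f : Hom Y X) (u : Y.V) (v : X.V) : Setoid (Intermediate f u v) where
  r := Equivalent
  iseqv :=
    { refl := fun I => ⟨Hom.id I.W, ⟨Function.bijective_id, Function.bijective_id,
        Function.bijective_id⟩, rfl, Hom.id_comp _, Hom.comp_id _⟩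
      symm := by
        rintro I J ⟨i, hi, hp, hg, hh⟩
        obtain ⟨k, hk, hki, hik⟩ := hi.exists_inv
        refine ⟨k, hk, ?_, ?_, ?_⟩
        · rw [← hp]
          exact congrFun (congrArg Hom.onV hki) I.pt
        · rw [← hg, ← Hom.comp_assoc, hki, Hom.id_comp]
        · rw [← hh, Hom.comp_assoc, hik, Hom.comp_id]
      trans := by
        rintro I J K ⟨i, hi, hp, hg, hh⟩ ⟨j, hj, hp', hg', hh'⟩
        refine ⟨j.comp i, hj.comp hi, ?_, ?_, ?_⟩
        · rw [← hp', ← hp]; rfl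
        · rw [Hom.comp_assoc, hg, hg']
        · rw [← Hom.comp_assoc, hh', hh] }

/-- `I ≤ J` if the middle complex of `J` covers that of `I`, compatibly with the maps from `Y` and
to `X` (hence with the base points). -/
def Below (I J : Intermediate f u v) : Prop :=
  ∃ p : Hom J.W I.W, p.IsCovering ∧ p.onV J.pt = I.pt ∧ p.comp J.g = I.g ∧ I.h.comp p = J.h

end Intermediate

/-- The set `ℒ(Y_u, X_v)` of equivalence classes of connected pointed coverings intermediate to
`f : Y_u → X_v`. -/
def CoverLattice {X Y : TwoComplex.{u}} (f : Hom Y X) (u : Y.V) (v : X.V) : Type (u + 1) :=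
  Quotient (Intermediate.equivSetoid f u v)

/-- The equivalence class of an intermediate covering. -/
def Intermediate.cls {X Y : TwoComplex.{u}} {f : Hom Y X} {u : Y.V} {v : X.V}
    (I : Intermediate f u v) : CoverLattice f u v :=
  Quotient.mk (Intermediate.equivSetoid f u v) I

/-- The order on equivalence classes, given by representatives. -/
instance {X Y : TwoComplex.{u}} (f : Hom Y X) (u : Y.V) (v : X.V) : LE (CoverLattice f u v) where
  le a b := ∃ I J : Intermediate f u v, I.cls = a ∧ J.cls = b ∧ I.Below J

end TwoComplex

/-- The relation `≤` of `α` is a partial order in which every two elements have a join and a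
meet. -/
def IsLatticeOrder (α : Type*) [LE α] : Prop :=
  ∃ L : Lattice α, ∀ a b : α, L.le a b ↔ a ≤ b

open TwoComplex

/-! An intermediate covering `Y → W → X` is determined, up to equivalence, by the vertices of `Y`
that it identifies. The relations that occur are the admissible ones: they refine the fibres of `f`,
and edges with equal image and related start vertices have related end vertices. The quotient by
such a relation is again a covering, because boundaries of faces of `X` lift to closed paths in `Y`
and so close up in the quotient. A larger covering corresponds to a smaller relation (`below_iff`,
`equivalent_iff`, `exists_ker_eq`), and admissible relations are closed under intersection, so the
intermediate coverings form a lattice.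

Excision rests on one fact, `SimplyConnected.eq_of_projV_eq`: a covering of `X` is injective on the
vertices of each component of the preimage of `Z`. Indeed, a path in such a component between two
points of one fibre maps to a closed path in `Z`; this is null-homotopic in `Z`, homotopies lift,
and so the path has the same end as the trivial one. Consequently a covering induces a covering of
the quotients (`SimplyConnected.isCovering_collapseHom`).

The same fact makes the passage to quotients reversible on relations: `a` and `b` are identified in
`W` exactly if `f a = f b` and their images are identified in the quotient of `W`
(`ker_iff_ker_excise`). Conversely, an admissible relation on the quotient of `Y`, pulled back to
`Y` and intersected with the kernel of `f`, is admissible (`exists_ker_excise_eq`). The Galois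
condition transfers because a lift of a closed path at `v` is closed exactly if its image in the
quotient is. -/

/-! ### Walks -/

theorem IsWalk.eq_end {V E : Type u} {s t : E → V} {a b c : V} {l : List E}
    (h : IsWalk s t a l b) (h' : IsWalk s t a l c) : b = c := by
  induction l generalizing a with
  | nil => exact Eq.trans (Eq.symm h) h'
  | cons e l ih => exact ih h.2 h'.2

theorem IsWalk.exists_of_append {V E : Type u} {s t : E → V} {a c : V} {l m : List E}
    (h : IsWalk s t a (l ++ m) c) : ∃ b, IsWalk s t a l b ∧ IsWalk s t b m c := by
  induction l generalizing a with
  | nil => exact ⟨a, rfl, h⟩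
  | cons e l ih =>
    obtain ⟨b, hb, hb'⟩ := ih h.2
    exact ⟨b, ⟨h.1, hb⟩, hb'⟩

/-- Unique path lifting for bare incidence data. It is also needed while a quotient complex is being
built, before there is any `TwoComplex` to speak of. -/
theorem IsWalk.unique_of_map {V E E' : Type u} {s t : E → V} {φ : E → E'}
    (hφ : ∀ e e', s e = s e' → φ e = φ e' → e = e') {a b b' : V} {l l' : List E}
    (h : IsWalk s t a l b) (h' : IsWalk s t a l' b') (hl : l.map φ = l'.map φ) :
    l = l' ∧ b = b' := by
  induction l generalizing a l' with
  | nil =>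
    cases l' with
    | nil => exact ⟨rfl, Eq.trans (Eq.symm h) h'⟩
    | cons e' l' => simp at hl
  | cons e l ih =>
    cases l' with
    | nil => simp at hl
    | cons e' l' =>
      simp only [List.map_cons, List.cons.injEq] at hl
      obtain rfl := hφ _ _ (h.1.trans h'.1.symm) hl.1
      obtain ⟨rfl, rfl⟩ := ih h.2 h'.2 hl.2
      exact ⟨rfl, rfl⟩

namespace TwoComplex

theorem tgt_einv (X : TwoComplex.{u}) (e : X.E) : X.tgt (X.einv e) = X.src e := by
  rw [tgt, X.einv_einv]

theorem src_einv (X : TwoComplex.{u}) (e : X.E) : X.src (X.einv e) = X.tgt e := rfl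

theorem Path.inv {X : TwoComplex.{u}} {a b : X.V} {l : List X.E} (h : X.Path a l b) :
    X.Path b (l.map X.einv).reverse a :=
  IsWalk.reverse X.einv_einv h

/-! ### Boundary circles of faces -/

section Boundary

variable (X : TwoComplex.{u}) (σ : X.F)

/-- No bound on `i` is needed: past the end of the word `vertexAt` defaults to the base, which is
where the full boundary path ends. -/
theorem path_take_drop (i : ℕ) :
    X.Path (X.base σ) ((X.word σ).take i) (X.vertexAt σ i) ∧
      X.Path (X.vertexAt σ i) ((X.word σ).drop i) (X.base σ) := by
  have h := X.word_closed σ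
  rw [← List.take_append_drop i (X.word σ)] at h
  obtain ⟨b, hb, hb'⟩ := h.exists_of_append
  suffices X.vertexAt σ i = b by rw [this]; exact ⟨hb, hb'⟩
  rw [vertexAt, ← List.head?_drop]
  cases hd : (X.word σ).drop i with
  | nil => rw [hd] at hb'; exact Eq.symm hb'
  | cons e l => rw [hd] at hb'; exact hb'.1

theorem vertexAt_zero : X.vertexAt σ 0 = X.base σ :=
  ((X.path_take_drop σ 0).1 : _ = _).symm

theorem le_length_of_lt_size {X : TwoComplex.{u}} {σ : X.F} {i : ℕ} (hi : i < X.size σ) :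
    i ≤ (X.word σ).length := by
  unfold size at hi; omega

theorem path_rotate {i : ℕ} (hi : i ≤ (X.word σ).length) :
    X.Path (X.vertexAt σ i) ((X.word σ).rotate i) (X.vertexAt σ i) := by
  rw [List.rotate_eq_drop_append_take hi]
  exact (X.path_take_drop σ i).2.append (X.path_take_drop σ i).1

/-- The reversed circle has the same base vertex, so `vᵢ` is reached on it after the remaining `n -
i` edges; the reduction modulo `n` matters only for `i = 0`. -/
theorem vertexAt_finv {i : ℕ} (hi : i < X.size σ) :
    X.vertexAt (X.finv σ) ((X.size σ - i) % X.size σ) = X.vertexAt σ i := by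
  rcases Nat.eq_zero_or_pos i with rfl | h0
  · rw [Nat.sub_zero, Nat.mod_self, vertexAt_zero, vertexAt_zero, X.base_finv]
  · have hn : X.size σ = (X.word σ).length := by unfold size at *; omega
    rw [Nat.mod_eq_of_lt (by omega), hn]
    have h1 := (X.path_take_drop (X.finv σ) ((X.word σ).length - i)).1
    have h2 := (X.path_take_drop σ i).2.inv
    have h3 : (X.word (X.finv σ)).take ((X.word σ).length - i) =
        (((X.word σ).drop i).map X.einv).reverse := by
      rw [X.word_finv, List.take_reverse, List.length_map, List.map_drop]
      congr 2; omega
    rw [h3, X.base_finv] at h1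
    exact IsWalk.eq_end h1 h2

/-- Rotations of the boundary word agree modulo the size of the boundary sphere. -/
theorem rotate_word_congr {i j : ℕ} (h : i % X.size σ = j % X.size σ) :
    (X.word σ).rotate i = (X.word σ).rotate j := by
  rcases Nat.eq_zero_or_pos (X.word σ).length with h0 | h0
  · rw [List.length_eq_zero_iff.1 h0]; simp
  · have hn : X.size σ = (X.word σ).length := max_eq_right h0
    rw [← List.rotate_mod, ← hn, h, hn, List.rotate_mod]

end Boundary

/-! ### Lifting edges, faces and paths along coverings -/

namespace Hom

variable {X Y W : TwoComplex.{u}}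

theorem onV_tgt (f : Hom Y X) (e : Y.E) : f.onV (Y.tgt e) = X.tgt (f.onE e) := by
  rw [tgt, f.onV_src, f.onE_einv]; rfl

theorem path_map (f : Hom Y X) {a b : Y.V} {l : List Y.E} (h : Y.Path a l b) :
    X.Path (f.onV a) (l.map f.onE) (f.onV b) := by
  induction l generalizing a with
  | nil => exact congrArg _ h
  | cons e l ih =>
    refine ⟨?_, ?_⟩
    · rw [← f.onV_src]; exact congrArg _ h.1
    · rw [← f.onV_tgt]; exact ih h.2

namespace IsCovering

variable {f : Hom Y X}

theorem edge_ext (hf : f.IsCovering) {e e' : Y.E} (hs : Y.src e = Y.src e')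
    (h : f.onE e = f.onE e') : e = e' :=
  (hf.1 (Y.src e')).2.1 hs rfl h

theorem exists_edge (hf : f.IsCovering) {a : Y.V} {e : X.E} (h : X.src e = f.onV a) :
    ∃ e', Y.src e' = a ∧ f.onE e' = e :=
  (hf.1 a).2.2 h

theorem face_ext (hf : f.IsCovering) {σ σ' : Y.F} {i i' : ℕ} (hi : i < Y.size σ)
    (hi' : i' < Y.size σ') (hv : Y.vertexAt σ i = Y.vertexAt σ' i')
    (hF : f.onF σ = f.onF σ') (h : f.eps σ i = f.eps σ' i') : σ = σ' ∧ i = i' :=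
  Prod.ext_iff.1 ((hf.2 (Y.vertexAt σ' i') (f.onF σ')).2.1 (x₁ := (σ, i)) (x₂ := (σ', i'))
    ⟨hF, hi, hv⟩ ⟨rfl, hi', rfl⟩ h)

theorem exists_face (hf : f.IsCovering) {a : Y.V} {τ : X.F} {j : ℕ} (hj : j < X.size τ)
    (h : X.vertexAt τ j = f.onV a) :
    ∃ σ i, f.onF σ = τ ∧ i < Y.size σ ∧ Y.vertexAt σ i = a ∧ f.eps σ i = j := by
  obtain ⟨⟨σ, i⟩, ⟨h1, h2, h3⟩, h4⟩ := (hf.2 a τ).2.2 ⟨hj, h⟩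
  exact ⟨σ, i, h1, h2, h3, h4⟩

theorem exists_lift (hf : f.IsCovering) {a : Y.V} {c : X.V} {l : List X.E}
    (h : X.Path (f.onV a) l c) :
    ∃ m b, Y.Path a m b ∧ m.map f.onE = l ∧ f.onV b = c := by
  induction l generalizing a with
  | nil => exact ⟨[], a, rfl, rfl, h⟩
  | cons e l ih =>
    obtain ⟨e', rfl, rfl⟩ := hf.exists_edge h.1
    have h2 := h.2
    rw [← f.onV_tgt] at h2
    obtain ⟨m, b, h3, rfl, h5⟩ := ih h2
    exact ⟨e' :: m, b, ⟨rfl, h3⟩, rfl, h5⟩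

theorem lift_unique (hf : f.IsCovering) {a b b' : Y.V} {m m' : List Y.E}
    (h : Y.Path a m b) (h' : Y.Path a m' b') (hm : m.map f.onE = m'.map f.onE) :
    m = m' ∧ b = b' :=
  IsWalk.unique_of_map (fun _ _ => hf.edge_ext) h h' hm

/-- The boundary of a face, read from any of its vertices, lifts to closed paths. -/
theorem exists_closed_lift (hf : f.IsCovering) {a : Y.V} {τ : X.F} {j : ℕ} (hj : j < X.size τ)
    (h : X.vertexAt τ j = f.onV a) :
    ∃ m, Y.Path a m a ∧ m.map f.onE = (X.word τ).rotate j := by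
  obtain ⟨σ, i, rfl, hi, rfl, rfl⟩ := hf.exists_face hj h
  refine ⟨_, Y.path_rotate σ (le_length_of_lt_size hi), ?_⟩
  rw [List.map_rotate, f.map_word, List.rotate_rotate]
  refine X.rotate_word_congr _ ?_
  rw [eps, Nat.mod_mod, add_comm]

theorem onV_surjective (hf : f.IsCovering) (hX : X.Connected) (u : Y.V) :
    Function.Surjective f.onV := fun x => by
  obtain ⟨l, hl⟩ := hX.2 (f.onV u) x
  obtain ⟨-, b, -, -, hb⟩ := hf.exists_lift hl
  exact ⟨b, hb⟩

theorem onE_surjective (hf : f.IsCovering) (hX : X.Connected) (u : Y.V) :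
    Function.Surjective f.onE := fun e => by
  obtain ⟨a, ha⟩ := hf.onV_surjective hX u (X.src e)
  obtain ⟨e', -, he⟩ := hf.exists_edge ha.symm
  exact ⟨e', he⟩

end IsCovering

/-! ### Maps into the total space of a covering -/

theorem eps_lt (f : Hom Y X) (σ : Y.F) (i : ℕ) : f.eps σ i < X.size (f.onF σ) :=
  Nat.mod_lt _ (X.size_pos _)

theorem eps_comp (h : Hom W X) (g : Hom Y W) (σ : Y.F) (i : ℕ) :
    (h.comp g).eps σ i = h.eps (g.onF σ) (g.eps σ i) := by
  have hs := h.size_onF (g.onF σ)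
  simp only [comp, eps, Function.comp_apply]
  rw [← hs, Nat.add_mod_mod, Nat.mod_add_mod, add_assoc]

theorem eps_injOn (f : Hom Y X) {σ : Y.F} {i j : ℕ} (hi : i < Y.size σ) (hj : j < Y.size σ)
    (h : f.eps σ i = f.eps σ j) : i = j := by
  rw [← f.size_onF] at hi hj
  have : i ≡ j [MOD X.size (f.onF σ)] := Nat.ModEq.add_right_cancel' (f.rot σ) h
  rwa [Nat.ModEq, Nat.mod_eq_of_lt hi, Nat.mod_eq_of_lt hj] at this

theorem exists_eps_eq (f : Hom Y X) {σ : Y.F} {k : ℕ} (hk : k < X.size (f.onF σ)) :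
    ∃ i < Y.size σ, f.eps σ i = k := by
  have hr := f.rot_lt σ
  refine ⟨(k + (X.size (f.onF σ) - f.rot σ)) % X.size (f.onF σ), ?_, ?_⟩
  · rw [← f.size_onF]; exact Nat.mod_lt _ (X.size_pos _)
  · rw [eps, Nat.mod_add_mod, add_assoc, Nat.sub_add_cancel hr.le, Nat.add_mod_right,
      Nat.mod_eq_of_lt hk]

/-- A map into the total space of a covering is determined by its composition with the covering
and its values on vertices. -/
theorem eq_of_comp_eq {h : Hom W X} (hh : h.IsCovering) {k k' : Hom Y W}
    (hV : k.onV = k'.onV) (hc : h.comp k = h.comp k') : k = k' := by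
  have hE : k.onE = k'.onE := funext fun e => hh.edge_ext
    (by rw [← k.onV_src, ← k'.onV_src, hV]) (congrFun (congrArg Hom.onE hc) e)
  have hF : ∀ σ, k.onF σ = k'.onF σ ∧ k.rot σ = k'.rot σ := fun σ =>
    hh.face_ext (k.rot_lt σ) (k'.rot_lt σ) (by rw [← k.onV_base, ← k'.onV_base, hV])
      (congrFun (congrArg Hom.onF hc) σ) (congrFun (congrArg Hom.rot hc) σ)
  ext σ
  · rw [hV]
  · rw [hE]
  · exact (hF σ).1
  · exact (hF σ).2

/-- A map between coverings of `X`, commuting with the maps to `X`, is a covering. -/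
theorem isCovering_of_comp {h : Hom W X} {p : Hom Y W} (hh : h.IsCovering)
    (hp : (h.comp p).IsCovering) : p.IsCovering := by
  refine ⟨fun a => ⟨?_, ?_, ?_⟩, fun a τ => ⟨?_, ?_, ?_⟩⟩
  · rintro e rfl
    exact (p.onV_src e).symm
  · intro e he e' he' hee
    exact hp.edge_ext (he.trans he'.symm) (congrArg h.onE hee)
  · intro e he
    obtain ⟨e', h1, h2⟩ := hp.exists_edge (a := a) (e := h.onE e)
      (by rw [← h.onV_src]; exact congrArg h.onV he)
    refine ⟨e', h1, hh.edge_ext ?_ h2⟩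
    rw [← p.onV_src, h1]; exact Eq.symm he
  · rintro ⟨σ, i⟩ ⟨rfl, hi, rfl⟩
    exact ⟨p.eps_lt σ i, (p.onV_vertexAt σ i hi).symm⟩
  · rintro ⟨σ, i⟩ ⟨h1, hi, h2⟩ ⟨σ', i'⟩ ⟨h1', hi', h2'⟩ he
    have := hp.face_ext hi hi' (h2.trans h2'.symm) (congrArg h.onF (h1.trans h1'.symm)) (by
      rw [eps_comp, eps_comp]
      have he : p.eps σ i = p.eps σ' i' := he
      rw [he, show p.onF σ = p.onF σ' from h1.trans h1'.symm])
    exact Prod.ext this.1 this.2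
  · rintro j ⟨hj, hv⟩
    obtain ⟨σ, i, h1, h2, h3, h4⟩ := hp.exists_face (a := a) (τ := h.onF τ) (j := h.eps τ j)
      (h.eps_lt _ _) (by rw [← h.onV_vertexAt _ _ hj, hv]; rfl)
    rw [eps_comp] at h4
    have := hh.face_ext (p.eps_lt σ i) hj
      (by rw [← p.onV_vertexAt _ _ h2, h3, hv]) h1 h4
    exact ⟨(σ, i), ⟨this.1, h2, h3⟩, this.2⟩

/-- A vertex map over `X` between the total spaces of a map and of a covering, compatible with
the end vertices of edges, extends to a map over `X`. -/
theorem exists_of_onV {h : Hom W X} (hh : h.IsCovering) (f : Hom Y X) (φ : Y.V → W.V)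
    (hφ : ∀ a, h.onV (φ a) = f.onV a)
    (hE : ∀ e e', f.onE e = h.onE e' → φ (Y.src e) = W.src e' → φ (Y.tgt e) = W.tgt e') :
    ∃ p : Hom Y W, p.onV = φ ∧ h.comp p = f := by
  have h1 : ∀ e : Y.E, ∃ e', W.src e' = φ (Y.src e) ∧ h.onE e' = f.onE e := fun e =>
    hh.exists_edge (by rw [hφ, f.onV_src])
  choose oE hs ho using h1
  -- The image of `σ` has to be the face over `f σ` whose boundary meets `φ (base σ)` at the
  -- position lying over `f.rot σ`; that position is then the rotation of the new map.
  have h2 : ∀ σ : Y.F, ∃ σ' i, h.onF σ' = f.onF σ ∧ i < W.size σ' ∧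
      W.vertexAt σ' i = φ (Y.base σ) ∧ h.eps σ' i = f.rot σ := fun σ =>
    hh.exists_face (f.rot_lt σ) (by rw [hφ, f.onV_base])
  choose oF r hF hr hv he using h2
  have ht : ∀ e, φ (Y.tgt e) = W.tgt (oE e) := fun e => hE e _ (ho e).symm (hs e).symm
  have hpath : ∀ {a b l}, Y.Path a l b → W.Path (φ a) (l.map oE) (φ b) := by
    intro a b l hl
    induction l generalizing a with
    | nil => exact congrArg _ hl
    | cons e l ih =>
      refine ⟨(hs e).trans (congrArg φ hl.1), ?_⟩
      rw [← ht]; exact ih hl.2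
  -- The face chosen for `σ⁻¹` and the inverse of the face chosen for `σ` appear at the same vertex
  -- over the same position, so the covering condition identifies them together with their
  -- positions.
  have hfinv : ∀ σ, oF (Y.finv σ) = W.finv (oF σ) ∧
      r (Y.finv σ) = (W.size (oF σ) - r σ) % W.size (oF σ) := by
    intro σ
    refine hh.face_ext (hr _) ?_ ?_ ?_ ?_
    · rw [size_finv]; exact Nat.mod_lt _ (W.size_pos _)
    · rw [hv, Y.base_finv, W.vertexAt_finv _ (hr σ), hv]
    · rw [hF, f.onF_finv, h.onF_finv, hF]
    · rw [he]
      have e1 := f.rot_finv σ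
      have e2 := h.rot_finv (oF σ)
      have e3 := he σ
      have hs1 := h.size_onF (oF σ)
      rw [eps, h.onF_finv, hF, size_finv]
      rw [hF] at hs1 e2
      rw [eps, hF] at e3
      have e4 := f.rot_lt (Y.finv σ)
      rw [f.onF_finv, size_finv] at e4
      have e5 := hr σ
      rw [← hs1] at e5 ⊢
      rw [Nat.mod_add_mod, ← Nat.mod_eq_of_lt e4]
      generalize X.size (f.onF σ) = n at *
      -- Adding `r σ + h.rot (oF σ)` to both sides removes the subtraction; each side is then `0`
      -- modulo `n`, since rotations of inverse faces cancel.
      have : f.rot (Y.finv σ) + (r σ + h.rot (oF σ)) ≡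
          (n - r σ + h.rot (W.finv (oF σ))) + (r σ + h.rot (oF σ)) [MOD n] := by
        have a1 : f.rot (Y.finv σ) + (r σ + h.rot (oF σ)) ≡ f.rot σ + f.rot (Y.finv σ)
            [MOD n] := by
          rw [add_comm (f.rot σ)]
          refine Nat.ModEq.add_left _ ?_
          rw [Nat.ModEq, e3, Nat.mod_eq_of_lt (by rw [← e3]; exact Nat.mod_lt _ (by omega))]
        have a2 : (n - r σ + h.rot (W.finv (oF σ))) + (r σ + h.rot (oF σ)) =
            n + (h.rot (oF σ) + h.rot (W.finv (oF σ))) := by omega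
        rw [a2]
        refine a1.trans ?_
        rw [Nat.ModEq, e1, Nat.add_mod_left, e2]
      exact Nat.ModEq.add_right_cancel' _ this
  refine ⟨⟨φ, oE, oF, r, fun e => (hs e).symm, fun e => ?_, fun σ => (hfinv σ).1, hr,
    fun σ => (hv σ).symm, fun σ => ?_, fun σ => ?_⟩, rfl, ?_⟩
  · refine hh.edge_ext ?_ ?_
    · rw [hs, src_einv, ht, src_einv]
    · rw [ho, f.onE_einv, h.onE_einv, ho]
  -- Both words are lifts, from the same vertex, of one boundary path in `X`.
  · have p1 := hpath (Y.word_closed σ)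
    have p2 := W.path_rotate (oF σ) (le_length_of_lt_size (hr σ))
    rw [hv] at p2
    refine (hh.lift_unique p1 p2 ?_).1
    rw [List.map_map, List.map_rotate, h.map_word, List.rotate_rotate,
      show h.onE ∘ oE = f.onE from funext ho, f.map_word, hF]
    have e3 := he σ
    have e4 := f.rot_lt σ
    rw [eps, hF] at e3
    refine X.rotate_word_congr _ ?_
    rw [Nat.mod_eq_of_lt e4, ← e3, add_comm]
  · have := hr σ
    rw [(hfinv σ).2, Nat.add_mod_mod, Nat.add_sub_cancel' this.le, Nat.mod_self]
  · ext σ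
    · exact hφ _
    · exact ho _
    · exact hF σ
    · exact he σ

end Hom

end TwoComplex

/-! ### Admissible relations and quotient coverings -/

namespace TwoComplex

theorem Connected.of_surjective {W Y : TwoComplex.{u}} (hY : Y.Connected) (g : Hom Y W)
    (hg : Function.Surjective g.onV) : W.Connected := by
  refine ⟨hY.1.map g.onV, fun a b => ?_⟩
  obtain ⟨a, rfl⟩ := hg a
  obtain ⟨b, rfl⟩ := hg b
  obtain ⟨l, hl⟩ := hY.2 a b
  exact ⟨_, g.path_map hl⟩

namespace Hom

variable {X Y W : TwoComplex.{u}}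

/-- The equivalence relations on the vertices of `Y` that are the kernels of the maps from `Y` to
coverings intermediate to `f`: they refine the kernel of `f` and are compatible with edges. -/
def IsAdmissible (f : Hom Y X) (R : Setoid Y.V) : Prop :=
  (∀ a b, R a b → f.onV a = f.onV b) ∧
    ∀ e e', f.onE e = f.onE e' → R (Y.src e) (Y.src e') → R (Y.tgt e) (Y.tgt e')

/-- The identification of edges of `Y` that an equivalence relation on vertices induces. -/
def edgeSetoid (f : Hom Y X) (R : Setoid Y.V) : Setoid Y.E where
  r e e' := f.onE e = f.onE e' ∧ R (Y.src e) (Y.src e')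
  iseqv :=
    { refl := fun _ => ⟨rfl, R.refl _⟩
      symm := fun h => ⟨h.1.symm, R.symm h.2⟩
      trans := fun h h' => ⟨h.1.trans h'.1, R.trans h.2 h'.2⟩ }

namespace IsAdmissible

variable {f : Hom Y X} {R : Setoid Y.V}

/-- The start vertex of an edge class. -/
def src (_ : f.IsAdmissible R) : Quotient (f.edgeSetoid R) → Quotient R :=
  Quotient.map Y.src fun _ _ h => h.2

/-- The inverse of an edge class. -/
def einv (hR : f.IsAdmissible R) : Quotient (f.edgeSetoid R) → Quotient (f.edgeSetoid R) :=
  Quotient.map Y.einv fun e e' h =>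
    ⟨by rw [f.onE_einv, f.onE_einv, h.1], hR.2 e e' h.1 h.2⟩

/-- The induced map to the vertices of `X`. -/
def onV (hR : f.IsAdmissible R) : Quotient R → X.V := Quotient.lift f.onV hR.1

/-- The induced map to the edges of `X`. -/
def onE (_ : f.IsAdmissible R) : Quotient (f.edgeSetoid R) → X.E :=
  Quotient.lift f.onE fun _ _ h => h.1

theorem edge_ext (hR : f.IsAdmissible R) (e e' : Quotient (f.edgeSetoid R))
    (hs : hR.src e = hR.src e') (h : hR.onE e = hR.onE e') : e = e' := by
  induction e using Quotient.ind
  induction e' using Quotient.ind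
  exact Quotient.sound ⟨h, Quotient.exact hs⟩

theorem einv_einv (hR : f.IsAdmissible R) (e) : hR.einv (hR.einv e) = e := by
  induction e using Quotient.ind with | _ e => exact congrArg _ (Y.einv_einv e)

theorem onE_einv (hR : f.IsAdmissible R) (e) : hR.onE (hR.einv e) = X.einv (hR.onE e) := by
  induction e using Quotient.ind with | _ e => exact f.onE_einv e

theorem map_reverse_einv (hR : f.IsAdmissible R) (l : List (Quotient (f.edgeSetoid R))) :
    (l.map hR.einv).reverse.map hR.onE = ((l.map hR.onE).map X.einv).reverse := by
  rw [List.map_reverse, List.map_map, List.map_map]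
  exact congrArg _ (List.map_congr_left fun e _ => hR.onE_einv e)

theorem walk (hR : f.IsAdmissible R) {a b : Y.V} {l : List Y.E} (h : Y.Path a l b) :
    IsWalk hR.src (fun e => hR.src (hR.einv e)) (Quotient.mk R a)
      (l.map (Quotient.mk (f.edgeSetoid R))) (Quotient.mk R b) := by
  induction l generalizing a with
  | nil => exact congrArg _ h
  | cons e l ih => exact ⟨congrArg _ h.1, ih h.2⟩

theorem map_onE (hR : f.IsAdmissible R) (l : List Y.E) :
    (l.map (Quotient.mk (f.edgeSetoid R))).map hR.onE = l.map f.onE := by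
  rw [List.map_map]; rfl

/-- The face condition for `f` gives a closed lift of the boundary to `Y` at any representative of
the class; its image is the required word. -/
theorem exists_word (hR : f.IsAdmissible R) (hf : f.IsCovering)
    (σ : {p : X.F × Quotient R // hR.onV p.2 = X.base p.1}) :
    ∃ m : List (Quotient (f.edgeSetoid R)),
      IsWalk hR.src (fun e => hR.src (hR.einv e)) σ.1.2 m σ.1.2 ∧
        m.map hR.onE = X.word σ.1.1 := by
  obtain ⟨⟨τ, w⟩, h⟩ := σ
  induction w using Quotient.ind with | _ y =>
  obtain ⟨m, h1, h2⟩ := hf.exists_closed_lift (a := y) (X.size_pos τ)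
    ((X.vertexAt_zero τ).trans h.symm)
  exact ⟨_, hR.walk h1, by rw [hR.map_onE, h2, List.rotate_zero]⟩

/-- The covering of `X` intermediate to `f` with vertex set the quotient of that of `Y`. -/
noncomputable def quotient (hR : f.IsAdmissible R) (hf : f.IsCovering) : TwoComplex.{u} where
  V := Quotient R
  E := Quotient (f.edgeSetoid R)
  -- A face is coded by its image in `X` and the class of its base vertex. Since this base lies over
  -- the base in `X`, the map to `X` has rotation `0`.
  F := {p : X.F × Quotient R // hR.onV p.2 = X.base p.1}
  src := hR.src
  einv := hR.einv
  einv_einv := hR.einv_einv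
  einv_ne e h := X.einv_ne (hR.onE e) (by rw [← hR.onE_einv, h])
  finv σ := ⟨(X.finv σ.1.1, σ.1.2), by rw [X.base_finv]; exact σ.2⟩
  finv_finv σ := Subtype.ext (Prod.ext (X.finv_finv _) rfl)
  finv_ne σ h := X.finv_ne σ.1.1 (congrArg (fun p => p.1.1) h)
  base σ := σ.1.2
  word σ := (hR.exists_word hf σ).choose
  word_closed σ := (hR.exists_word hf σ).choose_spec.1
  base_finv _ := rfl
  word_finv σ := by
    have h1 := (hR.exists_word hf σ).choose_spec
    have h2 := (hR.exists_word hf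
      ⟨(X.finv σ.1.1, σ.1.2), by rw [X.base_finv]; exact σ.2⟩).choose_spec
    refine (IsWalk.unique_of_map hR.edge_ext h2.1 (h1.1.reverse hR.einv_einv) ?_).1
    exact h2.2.trans ((X.word_finv _).trans
      ((congrArg _ (congrArg _ h1.2.symm)).trans (hR.map_reverse_einv _).symm))

variable (hR : f.IsAdmissible R) (hf : f.IsCovering)

theorem map_word_quotient (σ : (hR.quotient hf).F) :
    ((hR.quotient hf).word σ).map hR.onE = X.word σ.1.1 :=
  (hR.exists_word hf σ).choose_spec.2

theorem map_take_word_quotient (σ : (hR.quotient hf).F) (i : ℕ) :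
    List.map hR.onE (((hR.quotient hf).word σ).take i) = (X.word σ.1.1).take i :=
  (List.map_take).trans (congrArg _ (hR.map_word_quotient hf σ))

/-- The covering map from the quotient of `Y` to `X`. -/
noncomputable def quotientHom : Hom (hR.quotient hf) X where
  onV := hR.onV
  onE := hR.onE
  onF σ := σ.1.1
  rot _ := 0
  onV_src e := by induction e using Quotient.ind with | _ e => exact f.onV_src e
  onE_einv := hR.onE_einv
  onF_finv _ := rfl
  rot_lt σ := X.size_pos _
  onV_base σ := σ.2.trans (X.vertexAt_zero _).symm
  map_word σ := by rw [List.rotate_zero]; exact hR.map_word_quotient hf σ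
  rot_finv _ := Nat.zero_mod _

/-- Edges and paths over `X` are determined by their start in the quotient. Hence an appearance of a
vertex at position `i` determines the face: walking back `i` edges finds its base class. -/
theorem quotientHom_isCovering : (hR.quotientHom hf).IsCovering := by
  have heps : ∀ σ : (hR.quotient hf).F, ∀ i < (hR.quotient hf).size σ,
      (hR.quotientHom hf).eps σ i = i := fun σ i hi =>
    Nat.mod_eq_of_lt (by rw [(hR.quotientHom hf).size_onF]; exact hi)
  refine ⟨fun a => ⟨?_, ?_, ?_⟩, fun a τ => ⟨?_, ?_, ?_⟩⟩
  · rintro e rfl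
    exact ((hR.quotientHom hf).onV_src e).symm
  · intro e he e' he' h
    exact hR.edge_ext e e' (Eq.trans he (Eq.symm he')) h
  · intro e he
    induction a using Quotient.ind with | _ y =>
    obtain ⟨e', rfl, rfl⟩ := hf.exists_edge (show X.src e = f.onV y from he)
    exact ⟨Quotient.mk _ e', rfl, rfl⟩
  · rintro ⟨σ, i⟩ ⟨rfl, hi, rfl⟩
    exact ⟨eps_lt _ σ i, ((hR.quotientHom hf).onV_vertexAt σ i hi).symm⟩
  · rintro ⟨σ, i⟩ ⟨h1, hi, h2⟩ ⟨σ', i'⟩ ⟨h1', hi', h2'⟩ he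
    change (hR.quotientHom hf).eps σ i = (hR.quotientHom hf).eps σ' i' at he
    dsimp only at h1 h1' hi hi' h2 h2'
    rw [heps _ _ hi, heps _ _ hi'] at he
    subst he
    have p1 := ((hR.quotient hf).path_take_drop σ i).1.inv
    have p2 := ((hR.quotient hf).path_take_drop σ' i).1.inv
    rw [h2] at p1
    rw [h2'] at p2
    have := (IsWalk.unique_of_map hR.edge_ext p1 p2 (by
      have key : ∀ ρ : (hR.quotient hf).F,
          ((((hR.quotient hf).word ρ).take i).map (hR.quotient hf).einv).reverse.map hR.onE =
            (((X.word ρ.1.1).take i).map X.einv).reverse := fun ρ =>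
        (hR.map_reverse_einv _).trans
          (congrArg (fun l => (l.map X.einv).reverse) (hR.map_take_word_quotient hf ρ i))
      rw [key, key, show σ.1.1 = σ'.1.1 from h1.trans h1'.symm])).2
    exact Prod.ext (Subtype.ext (Prod.ext (h1.trans h1'.symm) this)) rfl
  · rintro j ⟨hj, hv⟩
    induction a using Quotient.ind with | _ y =>
    -- The boundary read from `vⱼ` is lifted at `y` and cut where it passes the base of `τ`; the
    -- class of this point `b` is the base of the wanted face.
    obtain ⟨m, h1, h2⟩ := hf.exists_closed_lift (a := y) hj hv
    rw [List.rotate_eq_drop_append_take (le_length_of_lt_size hj)] at h2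
    obtain ⟨m₁, m₂, rfl, h3, h4⟩ := List.map_eq_append_iff.1 h2
    obtain ⟨b, hb1, hb2⟩ := h1.exists_of_append
    have hb : f.onV b = X.base τ := by
      have h5 := f.path_map hb1
      rw [h3, ← show X.vertexAt τ j = f.onV y from hv] at h5
      exact h5.eq_end (X.path_take_drop τ j).2
    let σ : (hR.quotient hf).F := ⟨(τ, Quotient.mk R b), hb⟩
    have hj' : j < (hR.quotient hf).size σ := by
      rw [← (hR.quotientHom hf).size_onF]; exact hj
    refine ⟨(σ, j), ⟨rfl, hj', ?_⟩, heps _ _ hj'⟩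
    refine (IsWalk.unique_of_map hR.edge_ext ((hR.quotient hf).path_take_drop σ j).1
      (hR.walk hb2) ?_).2
    exact (hR.map_take_word_quotient hf σ j).trans (h4.symm.trans (hR.map_onE _).symm)

end IsAdmissible

end Hom

/-! ### Intermediate coverings as admissible relations -/

namespace Intermediate

variable {X Y : TwoComplex.{u}} {f : Hom Y X} {u : Y.V} {v : X.V}

theorem h_g_onV (I : Intermediate f u v) (a : Y.V) : I.h.onV (I.g.onV a) = f.onV a :=
  congrFun (congrArg Hom.onV I.comp_eq) a

theorem h_g_onE (I : Intermediate f u v) (e : Y.E) : I.h.onE (I.g.onE e) = f.onE e :=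
  congrFun (congrArg Hom.onE I.comp_eq) e

/-- The identification of vertices made by `Y → W`. -/
def ker (I : Intermediate f u v) : Setoid Y.V := Setoid.ker I.g.onV

theorem ker_iff {I : Intermediate f u v} {a b : Y.V} : I.ker a b ↔ I.g.onV a = I.g.onV b :=
  Iff.rfl

theorem isAdmissible_ker (I : Intermediate f u v) : f.IsAdmissible I.ker := by
  refine ⟨fun a b h => ?_, fun e e' h hs => ?_⟩
  · rw [← I.h_g_onV, ← I.h_g_onV, ker_iff.1 h]
  · rw [ker_iff, I.g.onV_src, I.g.onV_src] at hs
    rw [ker_iff, I.g.onV_tgt, I.g.onV_tgt, I.h_cov.edge_ext hs (by rw [h_g_onE, h_g_onE, h])]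

/-- Every admissible equivalence relation is the kernel of an intermediate covering. -/
theorem exists_ker_eq (hY : Y.Connected) (hf : f.IsCovering) (huv : f.onV u = v)
    {R : Setoid Y.V} (hR : f.IsAdmissible R) : ∃ I : Intermediate f u v, I.ker = R := by
  have hc := hR.quotientHom_isCovering hf
  obtain ⟨g, hg, hgf⟩ := Hom.exists_of_onV hc f (Quotient.mk R) (fun _ => rfl) (by
    intro e e' h hs
    induction e' using Quotient.ind with | _ e' =>
    exact Quotient.sound (hR.2 e e' h (Quotient.exact hs)))
  refine ⟨⟨hR.quotient hf, hY.of_surjective g ?_, Quotient.mk R u, g, hR.quotientHom hf,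
    Hom.isCovering_of_comp hc (hgf.symm ▸ hf), hc, hgf, congrFun hg u, huv⟩, ?_⟩
  · rw [hg]; exact Quotient.mk_surjective
  · ext a b
    rw [ker_iff]
    change g.onV a = g.onV b ↔ _
    rw [hg]
    exact Quotient.eq

theorem g_surjective (I : Intermediate f u v) : Function.Surjective I.g.onV :=
  I.g_cov.onV_surjective I.conn u

/-- If `J.g` identifies fewer vertices, `I.g` factors through it on vertices. The factor respects
edges, since edges of `J.W` come from `Y`, and so extends to a map over `X`, which is automatically
a covering. -/
theorem below_iff {I J : Intermediate f u v} : I.Below J ↔ J.ker ≤ I.ker := by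
  constructor
  · rintro ⟨p, -, -, hp, -⟩ a b h
    have h2 : ∀ a, p.onV (J.g.onV a) = I.g.onV a := congrFun (congrArg Hom.onV hp)
    change I.g.onV a = I.g.onV b
    rw [← h2, ← h2, ker_iff.1 h]
  · intro h
    let φ : J.W.V → I.W.V := fun w => I.g.onV (Function.surjInv J.g_surjective w)
    have hφ : ∀ a, φ (J.g.onV a) = I.g.onV a := fun a =>
      h (Function.surjInv_eq J.g_surjective _)
    obtain ⟨p, hp, hpc⟩ := Hom.exists_of_onV I.h_cov J.h φ (fun w => by
        obtain ⟨a, rfl⟩ := J.g_surjective w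
        rw [hφ, h_g_onV, h_g_onV]) (by
      intro e e' he hs
      obtain ⟨e, rfl⟩ := J.g_cov.onE_surjective J.conn u e
      rw [← J.g.onV_src, hφ, I.g.onV_src] at hs
      rw [← J.g.onV_tgt, hφ, I.g.onV_tgt]
      refine congrArg _ (I.h_cov.edge_ext hs ?_)
      rw [h_g_onE, ← he, h_g_onE])
    refine ⟨p, Hom.isCovering_of_comp I.h_cov (hpc ▸ J.h_cov), ?_, ?_, hpc⟩
    · rw [hp, ← J.g_pt, hφ, I.g_pt]
    · refine Hom.eq_of_comp_eq I.h_cov (funext fun a => ?_) ?_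
      · change p.onV (J.g.onV a) = _
        rw [hp, hφ]
      · rw [← Hom.comp_assoc, hpc, J.comp_eq, I.comp_eq]

/-- Equal kernels give coverings both ways. They are mutually inverse on vertices, hence everywhere,
as maps over `X` into a covering are determined on vertices. -/
theorem equivalent_iff {I J : Intermediate f u v} : I.Equivalent J ↔ I.ker = J.ker := by
  constructor
  · rintro ⟨i, hi, -, hg, -⟩
    ext a b
    have h2 : ∀ a, i.onV (I.g.onV a) = J.g.onV a := congrFun (congrArg Hom.onV hg)
    rw [ker_iff, ker_iff, ← h2, ← h2, hi.1.1.eq_iff]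
  · intro h
    obtain ⟨p, hp, hpt, hpg, hph⟩ := below_iff.2 h.le
    obtain ⟨q, hq, hqt, hqg, hqh⟩ := below_iff.2 h.ge
    have h1 : p.comp q = Hom.id J.W := Hom.eq_of_comp_eq J.h_cov (funext fun a => by
      obtain ⟨a, rfl⟩ := J.g_surjective a
      change ((p.comp q).comp J.g).onV a = _
      rw [Hom.comp_assoc, hqg, hpg]; rfl) (by rw [← Hom.comp_assoc, hph, hqh, Hom.comp_id])
    have h2 : q.comp p = Hom.id I.W := Hom.eq_of_comp_eq I.h_cov (funext fun a => by
      obtain ⟨a, rfl⟩ := I.g_surjective a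
      change ((q.comp p).comp I.g).onV a = _
      rw [Hom.comp_assoc, hpg, hqg]; rfl) (by rw [← Hom.comp_assoc, hqh, hph, Hom.comp_id])
    have e1 {α β : Type u} {k : α → β} {k' : β → α} (h : k ∘ k' = id) (h' : k' ∘ k = id) :
        Function.Bijective k :=
      Function.bijective_iff_has_inverse.2 ⟨k', congrFun h', congrFun h⟩
    exact ⟨p, ⟨e1 (congrArg Hom.onV h1) (congrArg Hom.onV h2),
      e1 (congrArg Hom.onE h1) (congrArg Hom.onE h2),
      e1 (congrArg Hom.onF h1) (congrArg Hom.onF h2)⟩, hpt, hpg, hph⟩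

theorem cls_eq_iff {I J : Intermediate f u v} : I.cls = J.cls ↔ I.ker = J.ker :=
  Quotient.eq.trans equivalent_iff

theorem cls_le_iff {I J : Intermediate f u v} : I.cls ≤ J.cls ↔ J.ker ≤ I.ker := by
  constructor
  · rintro ⟨I', J', h1, h2, h⟩
    rw [← cls_eq_iff.1 h1, ← cls_eq_iff.1 h2]
    exact below_iff.1 h
  · exact fun h => ⟨I, J, rfl, rfl, below_iff.2 h⟩

theorem exists_cls_eq (a : CoverLattice f u v) : ∃ I : Intermediate f u v, I.cls = a :=
  Quotient.exists_rep a

end Intermediate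

/-! ### The lattice of intermediate coverings -/

namespace Hom

variable {X Y : TwoComplex.{u}}

/-- The meet of admissible relations. -/
def admissibleInf (f : Hom Y X) (S : Set {R : Setoid Y.V // f.IsAdmissible R}) :
    {R : Setoid Y.V // f.IsAdmissible R} :=
  -- The factor `Setoid.ker f.onV` is needed for the empty meet, where `sInf` alone would identify
  -- all vertices.
  ⟨Setoid.ker f.onV ⊓ sInf (Subtype.val '' S), fun _ _ h => h.1, fun e e' he h =>
    ⟨by change f.onV _ = f.onV _; rw [f.onV_tgt, f.onV_tgt, he], by
      rintro _ ⟨R, hR, rfl⟩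
      exact R.2.2 e e' he (h.2 R.1 ⟨R, hR, rfl⟩)⟩⟩

instance (f : Hom Y X) : InfSet {R : Setoid Y.V // f.IsAdmissible R} := ⟨f.admissibleInf⟩

theorem isGLB_admissibleInf (f : Hom Y X) (S : Set {R : Setoid Y.V // f.IsAdmissible R}) :
    IsGLB S (sInf S) :=
  ⟨fun R hR _ _ h => h.2 R.1 ⟨R, hR, rfl⟩, fun R hR _ _ h =>
    ⟨R.2.1 _ _ h, by rintro _ ⟨T, hT, rfl⟩; exact hR hT h⟩⟩

end Hom

/-- The kernel identifies the order with the dual of that of admissible relations, a complete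
lattice because it has all infima. -/
theorem isLatticeOrder_coverLattice {X Y : TwoComplex.{u}} (hY : Y.Connected) {f : Hom Y X}
    (hf : f.IsCovering) {u : Y.V} {v : X.V} (huv : f.onV u = v) :
    IsLatticeOrder (CoverLattice f u v) := by
  let := completeLatticeOfInf _ f.isGLB_admissibleInf
  let k : CoverLattice f u v → {R : Setoid Y.V // f.IsAdmissible R}ᵒᵈ :=
    fun a => OrderDual.toDual ⟨_, (Intermediate.exists_cls_eq a).choose.isAdmissible_ker⟩
  have hk : ∀ I : Intermediate f u v, k I.cls = OrderDual.toDual ⟨I.ker, I.isAdmissible_ker⟩ :=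
    fun I => congrArg OrderDual.toDual (Subtype.ext
      (Intermediate.cls_eq_iff.1 (Intermediate.exists_cls_eq I.cls).choose_spec))
  have hb : Function.Bijective k := by
    constructor
    · intro a b h
      obtain ⟨I, rfl⟩ := Intermediate.exists_cls_eq a
      obtain ⟨J, rfl⟩ := Intermediate.exists_cls_eq b
      rw [hk, hk] at h
      exact Intermediate.cls_eq_iff.2 (congrArg Subtype.val h)
    · intro R
      obtain ⟨I, hI⟩ := Intermediate.exists_ker_eq hY hf huv (OrderDual.ofDual R).2
      exact ⟨I.cls, (hk I).trans (Subtype.ext hI)⟩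
  let E := Equiv.ofBijective k hb
  have hle : ∀ a b : CoverLattice f u v, k a ≤ k b ↔ a ≤ b := by
    intro a b
    obtain ⟨I, rfl⟩ := Intermediate.exists_cls_eq a
    obtain ⟨J, rfl⟩ := Intermediate.exists_cls_eq b
    rw [hk, hk, Intermediate.cls_le_iff]
    rfl
  have hE : ∀ R, k (E.symm R) = R := E.apply_symm_apply
  let L : Lattice (CoverLattice f u v) :=
    { le := (· ≤ ·)
      sup := fun a b => E.symm (k a ⊔ k b)
      inf := fun a b => E.symm (k a ⊓ k b)
      le_refl := fun a => (hle a a).1 le_rfl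
      le_trans := fun a b c h h' => (hle a c).1 (((hle a b).2 h).trans ((hle b c).2 h'))
      le_antisymm := fun a b h h' => hb.1 (le_antisymm ((hle a b).2 h) ((hle b a).2 h'))
      le_sup_left := fun a b => (hle _ _).1 (by rw [hE]; exact le_sup_left)
      le_sup_right := fun a b => (hle _ _).1 (by rw [hE]; exact le_sup_right)
      sup_le := fun a b c h h' => (hle _ _).1 (by
        rw [hE]; exact sup_le ((hle _ _).2 h) ((hle _ _).2 h'))
      inf_le_left := fun a b => (hle _ _).1 (by rw [hE]; exact inf_le_left)
      inf_le_right := fun a b => (hle _ _).1 (by rw [hE]; exact inf_le_right)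
      le_inf := fun a b c h h' => (hle _ _).1 (by
        rw [hE]; exact le_inf ((hle _ _).2 h) ((hle _ _).2 h')) }
  exact ⟨L, fun a b => Iff.rfl⟩

end TwoComplex

/-! ### Collapsed boundary circles -/

namespace TwoComplex

theorem vertexAt_mod (X : TwoComplex.{u}) (σ : X.F) {k : ℕ} (hk : k ≤ (X.word σ).length) :
    X.vertexAt σ (k % X.size σ) = X.vertexAt σ k := by
  rcases lt_or_ge k (X.size σ) with h | h
  · rw [Nat.mod_eq_of_lt h]
  · have h1 : k = X.size σ := by unfold size at *; omega
    have h2 : (X.word σ).length ≤ k := by unfold size at *; omega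
    rw [← h1, Nat.mod_self, vertexAt_zero, vertexAt, List.getElem?_eq_none h2]
    rfl

namespace Subcomplex

variable {X Y W : TwoComplex.{u}}

section Positions

variable (A : Subcomplex X)

theorem trim_rotate (l : List X.E) {i : ℕ} (hi : i ≤ l.length) :
    A.trim (l.rotate i) = (A.trim l).rotate (A.trim (l.take i)).length := by
  rw [List.rotate_eq_drop_append_take hi, trim_append]
  conv_rhs => rw [← List.take_append_drop i l, trim_append]
  rw [List.take_append_drop, List.rotate_append_length_eq]

theorem length_trim_take_add_drop (l : List X.E) (i : ℕ) :
    (A.trim (l.take i)).length + (A.trim (l.drop i)).length = (A.trim l).length := by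
  rw [← List.length_append, ← trim_append, List.take_append_drop]

theorem length_trim_word_mod (σ : A.collapse.F) :
    (A.trim (X.word σ.1)).length % A.collapse.size σ = 0 := by
  change _ % max 1 (A.trim (X.word σ.1)).length = 0
  rcases Nat.eq_zero_or_pos (A.trim (X.word σ.1)).length with h | h
  · rw [h]; rfl
  · rw [max_eq_right h, Nat.mod_self]

theorem projPos_lt (σ : A.collapse.F) (i : ℕ) : A.projPos σ i < A.collapse.size σ :=
  Nat.mod_lt _ (A.collapse.size_pos σ)

theorem vertexAt_projPos (σ : A.collapse.F) (i : ℕ) :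
    A.collapse.vertexAt σ (A.projPos σ i) = A.projV (X.vertexAt σ.1 i) := by
  have hle := A.length_trim_take_add_drop (X.word σ.1) i
  rw [projPos, vertexAt_mod _ _ (by change _ ≤ (A.trim (X.word σ.1)).length; omega)]
  have h1 := (A.collapse.path_take_drop σ (A.trim ((X.word σ.1).take i)).length).1
  have h2 : (A.collapse.word σ).take (A.trim ((X.word σ.1).take i)).length =
      A.trim ((X.word σ.1).take i) := by
    change (A.trim (X.word σ.1)).take _ = _
    conv_lhs => rw [← List.take_append_drop i (X.word σ.1), trim_append]
    rw [List.take_append_drop]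
    exact List.take_left
  rw [h2] at h1
  exact h1.eq_end (A.trim_walk (X.path_take_drop σ.1 i).1)

/-- The witness `k` is the index in `l` of the surviving edge number `j`. -/
theorem exists_length_trim_take (l : List X.E) (j : ℕ) (hj : j < (A.trim l).length) :
    ∃ k < l.length, (A.trim (l.take k)).length = j := by
  induction l generalizing j with
  | nil => simp [trim] at hj
  | cons e l ih =>
    by_cases h : e ∈ A.E
    · rw [A.trim_cons_mem h] at hj
      obtain ⟨k, hk, rfl⟩ := ih j hj
      exact ⟨k + 1, Nat.succ_lt_succ hk, by rw [List.take_succ_cons, A.trim_cons_mem h]⟩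
    · rw [A.trim_cons_not_mem h] at hj
      cases j with
      | zero => exact ⟨0, Nat.succ_pos _, rfl⟩
      | succ j =>
        obtain ⟨k, hk, rfl⟩ := ih j (Nat.lt_of_succ_lt_succ hj)
        exact ⟨k + 1, Nat.succ_lt_succ hk, by
          rw [List.take_succ_cons, A.trim_cons_not_mem h, List.length_cons]⟩

theorem exists_projPos_eq (σ : A.collapse.F) {j : ℕ} (hj : j < A.collapse.size σ) :
    ∃ k < X.size σ.1, A.projPos σ k = j := by
  rcases lt_or_ge j (A.trim (X.word σ.1)).length with h | h
  · obtain ⟨k, hk, hk'⟩ := A.exists_length_trim_take _ j h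
    exact ⟨k, lt_of_lt_of_le hk (le_max_right _ _), by rw [projPos, hk', Nat.mod_eq_of_lt hj]⟩
  -- This case occurs only if every boundary edge is collapsed: the circle is then one vertex, with
  -- sole position `0`.
  · refine ⟨0, X.size_pos _, ?_⟩
    have : j < max 1 (A.trim (X.word σ.1)).length := hj
    have h0 : j = 0 := by omega
    rw [h0]
    exact Nat.zero_mod _

/-- Unless both positions are `0`, the first `j` edges of the reversed boundary are the inverses of
those from `vᵢ` on. The two counts of surviving edges then add up to a full turn. -/
theorem projPos_finv (σ : A.collapse.F) {i j : ℕ} (hi : i < X.size σ.1) (hj : j < X.size σ.1)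
    (hij : (i + j) % X.size σ.1 = 0) :
    (A.projPos σ i + A.projPos (A.collapse.finv σ) j) % A.collapse.size σ = 0 := by
  rw [projPos, projPos, size_finv, ← Nat.add_mod]
  rcases Nat.eq_zero_or_pos (i + j) with h0 | h0
  · obtain ⟨rfl, rfl⟩ := Nat.add_eq_zero_iff.1 h0
    exact Nat.zero_mod _
  · have hs : i + j = X.size σ.1 := by
      obtain ⟨c, hc⟩ := Nat.dvd_of_mod_eq_zero hij
      have : c < 2 := by
        by_contra h
        have := Nat.mul_le_mul_left (X.size σ.1) (not_lt.1 h)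
        omega
      interval_cases c <;> omega
    have hl : i + j = (X.word σ.1).length := by unfold size at *; omega
    have h1 : (X.word (A.collapse.finv σ).1).take j =
        (((X.word σ.1).drop i).map X.einv).reverse := by
      change (X.word (X.finv σ.1)).take j = _
      rw [X.word_finv, List.take_reverse, List.length_map, List.map_drop]
      congr 2; omega
    rw [h1, trim_reverse, List.length_reverse, List.length_map, length_trim_take_add_drop,
      length_trim_word_mod]

/-- Surviving edges before `vᵣ` and those on the next `i` edges together count the way to `vᵢ₊ᵣ`;
passing the base adds one full turn, which is `0` modulo the size. -/
theorem projPos_rotate (σ : A.collapse.F) {i r : ℕ} (hi : i < X.size σ.1)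
    (hr : r < X.size σ.1) :
    ((A.trim (((X.word σ.1).rotate r).take i)).length + A.projPos σ r) % A.collapse.size σ =
      A.projPos σ ((i + r) % X.size σ.1) := by
  have hrl := le_length_of_lt_size hr
  rw [projPos, projPos, Nat.add_mod_mod, List.rotate_eq_drop_append_take hrl]
  rcases le_or_gt (i + r) (X.word σ.1).length with h | h
  · rw [List.take_append_of_le_length (by rw [List.length_drop]; omega), add_comm,
      ← List.length_append, ← trim_append, ← List.take_add, add_comm]
    rcases lt_or_ge (i + r) (X.size σ.1) with h' | h'
    · rw [Nat.mod_eq_of_lt h']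
    · have h1 : i + r = X.size σ.1 := by unfold size at *; omega
      have h2 : (X.word σ.1).length ≤ i + r := by unfold size at *; omega
      rw [List.take_of_length_le h2, length_trim_word_mod, h1, Nat.mod_self]
      exact (Nat.zero_mod _).symm
  · have hs : X.size σ.1 = (X.word σ.1).length := by unfold size at *; omega
    rw [hs] at hi hr ⊢
    rw [List.take_append, List.take_of_length_le (by rw [List.length_drop]; omega),
      trim_append, List.length_append, List.length_drop, List.take_take, add_assoc, add_comm,
      add_assoc, length_trim_take_add_drop, Nat.add_mod, length_trim_word_mod, add_zero,
      Nat.mod_mod, min_eq_left (by omega), Nat.mod_eq_sub_mod h.le,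
      Nat.mod_eq_of_lt (by omega : i + r - (X.word σ.1).length < _)]
    congr 4
    omega

end Positions

/-! ### Maps induced on quotients -/

/-- The preimage is a variable `B` with an equation so that one quotient of `Y`, formed from the
preimage under `f`, serves as the source for every intermediate covering. -/
theorem trim_map {g : Hom Y W} {A : Subcomplex W} {B : Subcomplex Y} (hAB : A.comap g = B)
    (hE : ∀ e : {e : Y.E // e ∉ B.E}, g.onE e.1 ∉ A.E) (l : List Y.E) :
    (B.trim l).map (fun e => (⟨g.onE e.1, hE e⟩ : {e : W.E // e ∉ A.E})) =
      A.trim (l.map g.onE) := by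
  induction l with
  | nil => rfl
  | cons e l ih =>
    by_cases h : e ∈ B.E
    · rw [B.trim_cons_mem h, ih, List.map_cons, A.trim_cons_mem]
      rw [← hAB] at h; exact h
    · rw [B.trim_cons_not_mem h, List.map_cons, ih, List.map_cons, A.trim_cons_not_mem]

/-- The map of quotient complexes induced by a map `Y → W`, where `A` is a subcomplex of `W` and
`B` is its preimage. -/
noncomputable def collapseHom (g : Hom Y W) (A : Subcomplex W) (B : Subcomplex Y)
    (hAB : A.comap g = B) : Hom B.collapse A.collapse :=
  have hE : ∀ e : {e : Y.E // e ∉ B.E}, g.onE e.1 ∉ A.E := by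
    subst hAB; exact fun e => e.2
  have hF : ∀ σ : {σ : Y.F // σ ∉ B.F}, g.onF σ.1 ∉ A.F := by
    subst hAB; exact fun σ => σ.2
  { onV := Quotient.map g.onV (by
      rintro a b ⟨l, hl, hl'⟩
      refine ⟨l.map g.onE, g.path_map hl, fun e he => ?_⟩
      obtain ⟨e', he', rfl⟩ := List.mem_map.1 he
      have := hl' e' he'
      rw [← hAB] at this; exact this)
    onE := fun e => ⟨g.onE e.1, hE e⟩
    onF := fun σ => ⟨g.onF σ.1, hF σ⟩
    -- The base vertex goes to the vertex with label `g.rot σ`, whose label on the collapsed circle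
    -- is its `projPos`.
    rot := fun σ => A.projPos ⟨g.onF σ.1, hF σ⟩ (g.rot σ.1)
    onV_src := fun e => congrArg _ (g.onV_src e.1)
    onE_einv := fun e => Subtype.ext (g.onE_einv e.1)
    onF_finv := fun σ => Subtype.ext (g.onF_finv σ.1)
    rot_lt := fun σ => A.projPos_lt _ _
    onV_base := fun σ => (congrArg A.projV (g.onV_base σ.1)).trans
      (A.vertexAt_projPos ⟨g.onF σ.1, hF σ⟩ _).symm
    map_word := fun σ => by
      refine (trim_map hAB hE _).trans ?_
      rw [g.map_word, trim_rotate _ _ (le_length_of_lt_size (g.rot_lt σ.1))]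
      exact A.collapse.rotate_word_congr ⟨g.onF σ.1, hF σ⟩ (Nat.mod_mod _ _).symm
    rot_finv := fun σ => by
      have h1 : (⟨g.onF (B.collapse.finv σ).1, hF (B.collapse.finv σ)⟩ : A.collapse.F) =
          A.collapse.finv ⟨g.onF σ.1, hF σ⟩ := Subtype.ext (g.onF_finv σ.1)
      rw [h1]
      have h2 := g.rot_lt (Y.finv σ.1)
      rw [g.onF_finv, size_finv] at h2
      exact A.projPos_finv _ (g.rot_lt σ.1) h2 (g.rot_finv σ.1) }

section CollapseHom

variable {g : Hom Y W} {A : Subcomplex W} {B : Subcomplex Y} (hAB : A.comap g = B)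

theorem trim_map_onE (l : List Y.E) :
    A.trim (l.map g.onE) = (B.trim l).map (collapseHom g A B hAB).onE :=
  (trim_map hAB _ l).symm

theorem collapseHom_projV (a : Y.V) :
    (collapseHom g A B hAB).onV (B.projV a) = A.projV (g.onV a) := rfl

/-- Rotating and then collapsing agrees with collapsing and then rotating. This is what transports
appearances of vertices between the original and the collapsed circles. -/
theorem collapseHom_eps (σ : B.collapse.F) {i : ℕ} (hi : i < Y.size σ.1) :
    (collapseHom g A B hAB).eps σ (B.projPos σ i) =
      A.projPos ((collapseHom g A B hAB).onF σ) (g.eps σ.1 i) := by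
  have hs := (collapseHom g A B hAB).size_onF σ
  have h1 := A.projPos_rotate ((collapseHom g A B hAB).onF σ) (i := i) (r := g.rot σ.1)
    (by change i < W.size (g.onF σ.1); rw [g.size_onF]; exact hi) (g.rot_lt σ.1)
  refine Eq.trans ?_ h1
  change (B.projPos σ i + A.projPos _ (g.rot σ.1)) % _ = _
  rw [projPos, ← hs, Nat.mod_add_mod]
  congr 2
  change _ = (A.trim (((W.word (g.onF σ.1)).rotate (g.rot σ.1)).take i)).length
  rw [← g.map_word, ← List.map_take, trim_map_onE hAB]
  exact (List.length_map _).symm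

theorem isInduced_collapseHom : IsInduced A B g (collapseHom g A B hAB) := by
  refine ⟨?_, fun σ hB hA i hi => collapseHom_eps hAB ⟨σ, hB⟩ hi⟩
  rintro (a | e | σ)
  · rfl
  · by_cases h : e ∈ B.E
    · have h' : g.onE e ∈ A.E := by rw [← hAB] at h; exact h
      simp only [proj, h, dif_pos, Hom.onCell, Sum.map_inl, Sum.map_inr, h', collapseHom_projV,
        g.onV_src]
    · have h' : g.onE e ∉ A.E := by rw [← hAB] at h; exact h
      simp only [proj, h, dif_neg, Hom.onCell, Sum.map_inl, Sum.map_inr, h', not_false_eq_true]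
      rfl
  · by_cases h : σ ∈ B.F
    · have h' : g.onF σ ∈ A.F := by rw [← hAB] at h; exact h
      simp only [proj, h, dif_pos, Hom.onCell, Sum.map_inl, Sum.map_inr, h', collapseHom_projV]
      -- The base of `σ` need not go to the base of its image, but an initial part of the boundary,
      -- which lies in `A`, joins the two points.
      refine congrArg _ (Quotient.sound ?_)
      refine ⟨((W.word (g.onF σ)).take (g.rot σ)).map W.einv |>.reverse, ?_, ?_⟩
      · rw [g.onV_base]
        exact (W.path_take_drop _ _).1.inv
      · intro e he
        obtain ⟨e', he', rfl⟩ := List.mem_map.1 (List.mem_reverse.1 he)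
        exact A.einv_mem _ (A.word_mem _ h' _ (List.mem_of_mem_take he'))
    · have h' : g.onF σ ∉ A.F := by rw [← hAB] at h; exact h
      simp only [proj, h, dif_neg, Hom.onCell, Sum.map_inr, h', not_false_eq_true]
      rfl

theorem collapseHom_comp {h : Hom W X} {f : Hom Y X} {Z : Subcomplex X} (hZ : Z.comap h = A)
    (hZf : Z.comap f = B) (hf : h.comp g = f) :
    (collapseHom h Z A hZ).comp (collapseHom g A B hAB) = collapseHom f Z B hZf := by
  subst hf
  ext σ
  · induction σ using Quotient.ind
    rfl
  · rfl
  · rfl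
  · exact collapseHom_eps hZ ((collapseHom g A B hAB).onF σ) (g.rot_lt σ.1)

end CollapseHom

theorem projV_eq_iff (A : Subcomplex X) {a b : X.V} :
    A.projV a = A.projV b ↔ ∃ l, A.PathIn a l b := Quotient.eq

theorem projV_surjective (A : Subcomplex X) : Function.Surjective A.projV :=
  Quotient.mk_surjective

theorem connected_collapse (A : Subcomplex X) (hX : X.Connected) : A.collapse.Connected := by
  refine ⟨hX.1.map A.projV, fun a b => ?_⟩
  obtain ⟨a, rfl⟩ := A.projV_surjective a
  obtain ⟨b, rfl⟩ := A.projV_surjective b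
  obtain ⟨l, hl⟩ := hX.2 a b
  exact ⟨_, A.trim_walk hl⟩

/-- Every path in the quotient is the image of a path between given representatives of its end
vertices. -/
theorem exists_path_trim_eq (A : Subcomplex X) {a b : X.V} {l : List A.collapse.E}
    (h : A.collapse.Path (A.projV a) l (A.projV b)) : ∃ m, X.Path a m b ∧ A.trim m = l := by
  have htrim : ∀ m : List X.E, (∀ e ∈ m, e ∈ A.E) → A.trim m = [] := by
    intro m hm
    induction m with
    | nil => rfl
    | cons e m ih =>
      rw [A.trim_cons_mem (hm e List.mem_cons_self), ih fun e he => hm e (List.mem_cons_of_mem _ he)]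
  induction l generalizing a with
  | nil =>
    obtain ⟨m, hm, hm'⟩ := A.projV_eq_iff.1 h
    exact ⟨m, hm, htrim m hm'⟩
  | cons e l ih =>
    obtain ⟨m, hm, hm'⟩ := A.projV_eq_iff.1 (Eq.symm h.1 : A.projV a = A.projV (X.src e.1))
    obtain ⟨n, hn, rfl⟩ := ih (a := X.tgt e.1) h.2
    refine ⟨m ++ e.1 :: n, hm.append ⟨rfl, hn⟩, ?_⟩
    rw [trim_append, htrim m hm', A.trim_cons_not_mem e.2]
    rfl

/-! ### Coverings and simply connected subcomplexes -/

section Lifting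

variable {f : Hom Y X} {A : Subcomplex X}

theorem exists_lift_pathIn (hf : f.IsCovering) {a : Y.V} {c : X.V} {l : List X.E}
    (h : A.PathIn (f.onV a) l c) : ∃ m b, (A.comap f).PathIn a m b ∧ f.onV b = c := by
  obtain ⟨m, b, hm, rfl, hb⟩ := hf.exists_lift h.1
  exact ⟨m, b, ⟨hm, fun e he => h.2 _ (List.mem_map_of_mem he)⟩, hb⟩

/-- A path in `A` lifts to a path in the preimage of `A`, so representatives can be moved within
their component to lie over any prescribed point. -/
theorem exists_projV_eq (hf : f.IsCovering) {a : Y.V} {c : X.V}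
    (h : A.projV (f.onV a) = A.projV c) :
    ∃ b, f.onV b = c ∧ (A.comap f).projV a = (A.comap f).projV b := by
  obtain ⟨l, hl⟩ := A.projV_eq_iff.1 h
  obtain ⟨m, b, hm, hb⟩ := exists_lift_pathIn hf hl
  exact ⟨b, hb, (projV_eq_iff _).2 ⟨m, hm⟩⟩

/-- A spur or the boundary of a face lifts to closed paths. -/
theorem exists_closed_lift_of_elem (hf : f.IsCovering) {c : Y.V} {d : X.V} {r : List X.E}
    (hr : (∃ e ∈ A.E, r = [e, X.einv e]) ∨ ∃ σ ∈ A.F, ∃ k : ℕ, r = (X.word σ).rotate k)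
    (h : X.Path (f.onV c) r d) : ∃ m, Y.Path c m c ∧ m.map f.onE = r := by
  rcases hr with ⟨e, -, rfl⟩ | ⟨σ, -, k, rfl⟩
  · obtain ⟨e', rfl, rfl⟩ := hf.exists_edge h.1
    exact ⟨[e', Y.einv e'], ⟨rfl, rfl, Y.tgt_einv e'⟩, by
      rw [List.map_cons, List.map_cons, f.onE_einv]; rfl⟩
  · rcases Nat.eq_zero_or_pos (X.word σ).length with h0 | h0
    · exact ⟨[], rfl, by rw [List.length_eq_zero_iff.1 h0]; simp⟩
    · have hk : k % (X.word σ).length < X.size σ :=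
        lt_of_lt_of_le (Nat.mod_lt _ h0) (le_max_right _ _)
      rw [← List.rotate_mod] at h ⊢
      have h1 := X.path_rotate σ (le_length_of_lt_size hk)
      refine hf.exists_closed_lift hk ?_
      cases hw : (X.word σ).rotate (k % (X.word σ).length) with
      | nil => rw [List.rotate_eq_nil_iff] at hw; rw [hw] at h0; exact absurd h0 (lt_irrefl _)
      | cons e l => rw [hw] at h h1; exact h1.1.symm.trans h.1

/-- Inserted spurs and face boundaries lift to closed paths, so an elementary homotopy leaves the
end of the lift unchanged. For a deletion, unique lifting shows that the deleted part of the lift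
was closed. -/
theorem Homotopic.exists_lift (hf : f.IsCovering) {x y : X.V} {l l' : List X.E}
    (h : A.Homotopic x y l l') {a b : Y.V} (ha : f.onV a = x) :
    (∃ m, Y.Path a m b ∧ m.map f.onE = l) ↔ ∃ m, Y.Path a m b ∧ m.map f.onE = l' := by
  induction h with
  | refl => rfl
  | symm _ _ _ ih => exact ih.symm
  | trans _ _ _ _ _ ih ih' => exact ih.trans ih'
  | rel l l' h =>
    obtain ⟨-, h, p, q, r, rfl, rfl, hr⟩ := h
    obtain ⟨d, hpr, -⟩ := h.1.exists_of_append
    obtain ⟨d', hp, hrd⟩ := hpr.exists_of_append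
    have key : ∀ {c mp}, Y.Path a mp c → mp.map f.onE = p →
        ∃ m, Y.Path c m c ∧ m.map f.onE = r := by
      intro c mp h1 h2
      have h3 := f.path_map h1
      rw [h2, ha] at h3
      refine exists_closed_lift_of_elem hf hr (d := d) ?_
      rw [h3.eq_end hp]; exact hrd
    constructor
    · rintro ⟨m, hm, hm'⟩
      obtain ⟨mp, mq, rfl, hp', rfl⟩ := List.map_eq_append_iff.1 hm'
      obtain ⟨c, hc, hc'⟩ := hm.exists_of_append
      obtain ⟨mr, h1, rfl⟩ := key hc hp'
      exact ⟨mp ++ mr ++ mq, (hc.append h1).append hc', by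
        rw [List.map_append, List.map_append, hp']⟩
    · rintro ⟨m, hm, hm'⟩
      obtain ⟨mpr, mq, rfl, hpr', rfl⟩ := List.map_eq_append_iff.1 hm'
      obtain ⟨mp, mr, rfl, hp', hr'⟩ := List.map_eq_append_iff.1 hpr'
      obtain ⟨c, hc, hc'⟩ := hm.exists_of_append
      obtain ⟨c', hc1, hc2⟩ := hc.exists_of_append
      obtain ⟨m, h1, h2⟩ := key hc1 hp'
      obtain rfl := (hf.lift_unique h1 hc2 (h2.trans hr'.symm)).2
      exact ⟨mp ++ mq, hc1.append hc', by rw [List.map_append, hp']⟩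

/-- A covering is injective on each component of the preimage of a simply connected
subcomplex. -/
theorem SimplyConnected.eq_of_projV_eq (hA : A.SimplyConnected) (hf : f.IsCovering) {a b : Y.V}
    (h : (A.comap f).projV a = (A.comap f).projV b) (hab : f.onV a = f.onV b) : a = b := by
  obtain ⟨m, hm, hmA⟩ := (projV_eq_iff _).1 h
  -- The empty path is separate because the vertex may lie outside the preimage of `A`; a first edge
  -- forces it inside, where simple connectedness applies.
  cases m with
  | nil => exact hm
  | cons e m =>
    have h1 := f.path_map hm
    rw [← hab] at h1
    have h2 : A.Homotopic _ _ _ [] := hA (f.onV a) (by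
        have := A.src_mem _ (hmA e List.mem_cons_self)
        rw [← f.onV_src] at this
        rwa [show Y.src e = a from hm.1] at this) _ ⟨h1, fun e' he' => by
      obtain ⟨e'', he, rfl⟩ := List.mem_map.1 he'
      exact hmA e'' he⟩
    obtain ⟨m', h3, h4⟩ := (h2.exists_lift hf rfl (b := b)).1 ⟨_, hm, rfl⟩
    rw [List.map_eq_nil_iff] at h4
    rw [h4] at h3
    exact h3

/-- Squashing a simply connected subcomplex and the components of its preimage preserves
coverings. -/
theorem SimplyConnected.isCovering_collapseHom (hA : A.SimplyConnected) (hf : f.IsCovering)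
    {B : Subcomplex Y} (hB : A.comap f = B) : (collapseHom f A B hB).IsCovering := by
  subst hB
  refine ⟨fun a => ⟨?_, ?_, ?_⟩, fun a τ => ⟨?_, ?_, ?_⟩⟩
  · rintro e rfl
    exact ((collapseHom f A _ rfl).onV_src e).symm
  · intro e he e' he' h
    have h1 := congrArg Subtype.val h
    -- The start vertices lie in one component and over one vertex, hence coincide.
    refine Subtype.ext (hf.edge_ext (hA.eq_of_projV_eq hf (Eq.trans he (Eq.symm he')) ?_) h1)
    rw [f.onV_src, f.onV_src]
    exact congrArg _ h1
  · intro e he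
    obtain ⟨a, rfl⟩ := projV_surjective _ a
    obtain ⟨b, hb, hab⟩ := exists_projV_eq hf (a := a) (c := X.src e.1) (Eq.symm he)
    obtain ⟨e', h1, h2⟩ := hf.exists_edge hb.symm
    refine ⟨⟨e', fun h => e.2 (by rw [← h2]; exact h)⟩, ?_, Subtype.ext h2⟩
    change (A.comap f).projV (Y.src e') = _
    rw [h1, hab]
  · rintro ⟨σ, i⟩ ⟨rfl, hi, rfl⟩
    exact ⟨Hom.eps_lt _ _ _, ((collapseHom f A _ rfl).onV_vertexAt σ i hi).symm⟩
  · rintro ⟨σ, i⟩ ⟨h1, hi, h2⟩ ⟨σ', i'⟩ ⟨h1', hi', h2'⟩ he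
    change (collapseHom f A _ rfl).eps σ i = (collapseHom f A _ rfl).eps σ' i' at he
    dsimp only at h1 h2 hi h1' h2' hi'
    -- Both collapsed appearances are lifted to the original circles over one common position `k` of
    -- `τ`. Injectivity on components then makes the two vertices equal, and the covering condition
    -- for `f` applies.
    have key : ∀ ρ : (A.comap f).collapse.F, ∀ n k : ℕ,
        (collapseHom f A _ rfl).onF ρ = τ → n < (A.comap f).collapse.size ρ →
        k < X.size τ.1 → A.projPos τ k = (collapseHom f A _ rfl).eps ρ n →
        ∃ m < Y.size ρ.1, f.eps ρ.1 m = k ∧ (A.comap f).projPos ρ m = n := by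
      rintro ρ n k rfl hn hk hkn
      obtain ⟨m, hm, rfl⟩ := f.exists_eps_eq (σ := ρ.1) hk
      refine ⟨m, hm, rfl, (collapseHom f A _ rfl).eps_injOn (projPos_lt _ _ _) hn ?_⟩
      rw [← hkn, collapseHom_eps _ _ hm]
    obtain ⟨k, hk, hk'⟩ := A.exists_projPos_eq τ (j := (collapseHom f A _ rfl).eps σ i)
      (by rw [← h1]; exact Hom.eps_lt _ _ _)
    obtain ⟨m, hm, hmk, rfl⟩ := key σ i k h1 hi hk hk'
    obtain ⟨m', hm', hmk', rfl⟩ := key σ' i' k h1' hi' hk (hk'.trans he)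
    rw [vertexAt_projPos] at h2 h2'
    have hF : f.onF σ.1 = f.onF σ'.1 := congrArg Subtype.val (h1.trans h1'.symm)
    have hv := hA.eq_of_projV_eq hf (h2.trans h2'.symm) (by
      rw [f.onV_vertexAt _ _ hm, f.onV_vertexAt _ _ hm', hmk, hmk', hF])
    have h3 := hf.face_ext hm hm' hv hF (hmk.trans hmk'.symm)
    obtain rfl := Subtype.ext h3.1
    rw [h3.2]
  · rintro j ⟨hj, hv⟩
    obtain ⟨a, rfl⟩ := projV_surjective _ a
    obtain ⟨k, hk, rfl⟩ := A.exists_projPos_eq τ hj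
    rw [vertexAt_projPos] at hv
    obtain ⟨b, hb, hab⟩ := exists_projV_eq hf (a := a) (Eq.symm hv)
    obtain ⟨σ, i, h1, h2, h3, h4⟩ := hf.exists_face hk hb.symm
    have hσ : σ ∉ (A.comap f).F := fun h => τ.2 (by rw [← h1]; exact h)
    have h5 : (collapseHom f A _ rfl).onF ⟨σ, hσ⟩ = τ := Subtype.ext h1
    refine ⟨(⟨σ, hσ⟩, (A.comap f).projPos ⟨σ, hσ⟩ i), ⟨h5, projPos_lt _ _ _, ?_⟩, ?_⟩
    · rw [vertexAt_projPos, h3, hab]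
    · change (collapseHom f A _ rfl).eps _ _ = _
      rw [collapseHom_eps _ _ h2, h5, h4]

/-- A covering and the covering induced on quotients are Galois or not together. -/
theorem SimplyConnected.isGalois_collapseHom_iff (hA : A.SimplyConnected) (hf : f.IsCovering)
    {B : Subcomplex Y} (hB : A.comap f = B) (v : X.V) :
    f.IsGalois v ↔ (collapseHom f A B hB).IsGalois (A.projV v) := by
  have hc := hA.isCovering_collapseHom hf hB
  constructor
  · rintro ⟨-, hG⟩
    refine ⟨hc, fun γ hγ => ?_⟩
    obtain ⟨l, hl, rfl⟩ := A.exists_path_trim_eq hγ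
    -- Each lift in the quotient comes from a lift of `l` starting over `v` in the component `a`.
    -- Both its ends lie over `v`, so by injectivity on components it is closed exactly if the lift
    -- in the quotient is.
    have key : ∀ (a b : B.collapse.V) (μ : List B.collapse.E),
        (collapseHom f A B hB).onV a = A.projV v → B.collapse.Path a μ b →
        μ.map (collapseHom f A B hB).onE = A.trim l →
        ∃ a' b' m, f.onV a' = v ∧ Y.Path a' m b' ∧ m.map f.onE = l ∧ (b' = a' ↔ b = a) := by
      intro a b μ ha hμ hμl
      obtain ⟨a, rfl⟩ := projV_surjective _ a
      subst hB
      obtain ⟨a', rfl, ha'⟩ := exists_projV_eq hf (a := a) ha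
      obtain ⟨m, b', hm, rfl, hb⟩ := hf.exists_lift hl
      rw [ha'] at hμ ⊢
      have h1 := ((A.comap f).trim_walk hm : (A.comap f).collapse.Path _ _ _)
      have h2 := (hc.lift_unique hμ h1 (by rw [hμl, trim_map_onE rfl])).2
      refine ⟨a', b', m, rfl, hm, rfl, ?_⟩
      rw [h2]
      exact ⟨fun h => congrArg _ h, fun h => hA.eq_of_projV_eq hf h hb⟩
    intro u₁ w₁ u₂ w₂ μ₁ μ₂ h1 h2 h3 h4 h5 h6
    obtain ⟨a, b, m, h7, h8, h9, h10⟩ := key _ _ _ h1 h2 h3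
    obtain ⟨a', b', m', h7', h8', h9', h10'⟩ := key _ _ _ h4 h5 h6
    rw [← h10, ← h10']
    exact hG l hl _ _ _ _ m m' h7 h8 h9 h7' h8' h9'
  · rintro ⟨-, hG⟩
    refine ⟨hf, fun γ hγ u₁ w₁ u₂ w₂ μ₁ μ₂ h1 h2 h3 h4 h5 h6 => ?_⟩
    have key : ∀ {a b μ}, f.onV a = v → Y.Path a μ b → μ.map f.onE = γ →
        (b = a ↔ B.projV b = B.projV a) := by
      rintro a b μ rfl h h'
      subst hB
      refine ⟨fun h => congrArg _ h, fun h'' => hA.eq_of_projV_eq hf h'' ?_⟩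
      have h3 := f.path_map h
      rw [h'] at h3
      exact h3.eq_end hγ
    rw [key h1 h2 h3, key h4 h5 h6]
    refine hG (A.trim γ) (A.trim_walk hγ) _ _ _ _ (B.trim μ₁) (B.trim μ₂) ?_ (B.trim_walk h2) ?_
      ?_ (B.trim_walk h5) ?_
    · rw [collapseHom_projV, h1]
    · rw [← trim_map_onE, h3]
    · rw [collapseHom_projV, h4]
    · rw [← trim_map_onE, h6]

end Lifting

end Subcomplex

end TwoComplex

/-! ### Excision for intermediate coverings -/

namespace TwoComplex

namespace Intermediate

variable {X Y : TwoComplex.{u}} {f : Hom Y X} {u : Y.V} {v : X.V} {Z : Subcomplex X}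

theorem comap_comap (I : Intermediate f u v) (Z : Subcomplex X) :
    (Z.comap I.h).comap I.g = Z.comap f := by
  conv_rhs => rw [← I.comp_eq]
  rfl

/-- The intermediate covering obtained by squashing the preimages of a simply connected
subcomplex. -/
noncomputable def excise (hZ : Z.SimplyConnected) (hf : f.IsCovering) (I : Intermediate f u v) :
    Intermediate (Subcomplex.collapseHom f Z (Z.comap f) rfl) ((Z.comap f).projV u) (Z.projV v) where
  W := (Z.comap I.h).collapse
  conn := Subcomplex.connected_collapse _ I.conn
  pt := (Z.comap I.h).projV I.pt
  g := Subcomplex.collapseHom I.g (Z.comap I.h) (Z.comap f) (I.comap_comap Z)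
  h := Subcomplex.collapseHom I.h Z (Z.comap I.h) rfl
  g_cov := Hom.isCovering_of_comp (hZ.isCovering_collapseHom I.h_cov rfl) (by
    rw [Subcomplex.collapseHom_comp _ rfl rfl I.comp_eq]
    exact hZ.isCovering_collapseHom hf rfl)
  h_cov := hZ.isCovering_collapseHom I.h_cov rfl
  comp_eq := Subcomplex.collapseHom_comp _ rfl rfl I.comp_eq
  g_pt := by rw [Subcomplex.collapseHom_projV, I.g_pt]
  h_pt := by rw [Subcomplex.collapseHom_projV, I.h_pt]

variable (hZ : Z.SimplyConnected) (hf : f.IsCovering)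

/-- A path in the preimage of `Z` in `W` from the image of `b` to that of `a` lifts to `Y` starting
at `b`; its end is `c`. -/
theorem ker_excise_iff {I : Intermediate f u v} {a b : Y.V} :
    (I.excise hZ hf).ker ((Z.comap f).projV a) ((Z.comap f).projV b) ↔
      ∃ c, I.g.onV a = I.g.onV c ∧ (Z.comap f).projV c = (Z.comap f).projV b := by
  rw [ker_iff]
  change (Z.comap I.h).projV (I.g.onV a) = (Z.comap I.h).projV (I.g.onV b) ↔ _
  constructor
  · intro h
    obtain ⟨c, hc, hbc⟩ := Subcomplex.exists_projV_eq (A := Z.comap I.h) I.g_cov h.symm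
    rw [I.comap_comap] at hbc
    exact ⟨c, hc.symm, hbc.symm⟩
  · rintro ⟨c, hc, hcb⟩
    rw [hc]
    exact congrArg (Subcomplex.collapseHom I.g (Z.comap I.h) (Z.comap f) (I.comap_comap Z)).onV hcb

/-- This recovers the kernel from the excised one, because `W → X` is injective on the components of
the preimage of `Z`. -/
theorem ker_iff_ker_excise {I : Intermediate f u v} {a b : Y.V} :
    I.ker a b ↔ f.onV a = f.onV b ∧
      (I.excise hZ hf).ker ((Z.comap f).projV a) ((Z.comap f).projV b) := by
  constructor
  · exact fun h => ⟨I.isAdmissible_ker.1 a b h, (ker_excise_iff hZ hf).2 ⟨b, h, rfl⟩⟩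
  · rintro ⟨h, h'⟩
    refine hZ.eq_of_projV_eq I.h_cov (h' : (Z.comap I.h).projV _ = (Z.comap I.h).projV _) ?_
    rw [h_g_onV, h_g_onV, h]

theorem ker_excise_le_iff {I J : Intermediate f u v} :
    (J.excise hZ hf).ker ≤ (I.excise hZ hf).ker ↔ J.ker ≤ I.ker := by
  constructor
  · intro h a b hab
    rw [ker_iff_ker_excise hZ hf] at hab ⊢
    exact ⟨hab.1, h hab.2⟩
  · intro h a b hab
    obtain ⟨a, rfl⟩ := Subcomplex.projV_surjective _ a
    obtain ⟨b, rfl⟩ := Subcomplex.projV_surjective _ b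
    rw [ker_excise_iff] at hab ⊢
    obtain ⟨c, hc, hcb⟩ := hab
    exact ⟨c, h hc, hcb⟩

/-- Every intermediate covering of the quotients arises by squashing. -/
theorem exists_ker_excise_eq (hY : Y.Connected) (huv : f.onV u = v)
    (K : Intermediate (Subcomplex.collapseHom f Z (Z.comap f) rfl) ((Z.comap f).projV u) (Z.projV v)) :
    ∃ I : Intermediate f u v, (I.excise hZ hf).ker = K.ker := by
  -- The pullback alone would identify all points of a component of the preimage of `Z`;
  -- intersecting with the kernel of `f` keeps fibres apart.
  let R : Setoid Y.V := Setoid.ker f.onV ⊓ Setoid.comap (Z.comap f).projV K.ker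
  have hR : f.IsAdmissible R := by
    refine ⟨fun a b h => h.1, fun e e' he h => ⟨?_, ?_⟩⟩
    · change f.onV _ = f.onV _
      rw [f.onV_tgt, f.onV_tgt, he]
    · have h2 : K.ker ((Z.comap f).projV (Y.src e)) ((Z.comap f).projV (Y.src e')) := h.2
      change K.ker ((Z.comap f).projV (Y.tgt e)) ((Z.comap f).projV (Y.tgt e'))
      -- An edge over `Z` has both ends in one component, so nothing changes in the quotient; any
      -- other edge survives there, and admissibility of `K.ker` applies.
      by_cases hZe : f.onE e ∈ Z.E
      · have key : ∀ d, f.onE d ∈ Z.E →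
            (Z.comap f).projV (Y.src d) = (Z.comap f).projV (Y.tgt d) := fun d hd =>
          (Subcomplex.projV_eq_iff _).2 ⟨[d], ⟨rfl, rfl⟩, fun x hx => by
            rw [List.mem_singleton.1 hx]; exact hd⟩
        rw [← key e hZe, ← key e' (he ▸ hZe)]
        exact h2
      · exact K.isAdmissible_ker.2 ⟨e, hZe⟩ ⟨e', fun h => hZe (he ▸ h)⟩ (Subtype.ext he) h2
  obtain ⟨I, hI⟩ := exists_ker_eq (v := v) hY hf huv hR
  refine ⟨I, ?_⟩
  ext a b
  obtain ⟨a, rfl⟩ := Subcomplex.projV_surjective _ a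
  obtain ⟨b, rfl⟩ := Subcomplex.projV_surjective _ b
  rw [ker_excise_iff]
  have hI' : ∀ c, I.g.onV a = I.g.onV c ↔ R a c := fun c => by rw [← hI]; rfl
  constructor
  · rintro ⟨c, hc, hcb⟩
    rw [← hcb]
    exact ((hI' c).1 hc).2
  · intro h
    have h1 := K.isAdmissible_ker.1 _ _ h
    -- Only the images in `X/Z` are known to agree, so `b` is moved within its component to a point
    -- `c` in the fibre of `a`.
    obtain ⟨c, hc, hbc⟩ := Subcomplex.exists_projV_eq hf (A := Z) (a := b) (Eq.symm h1)
    refine ⟨c, (hI' c).2 ⟨hc.symm, ?_⟩, hbc.symm⟩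
    change K.ker _ ((Z.comap f).projV c)
    rw [← hbc]
    exact h

end Intermediate

namespace CoverLattice

variable {X Y : TwoComplex.{u}} {f : Hom Y X} {u : Y.V} {v : X.V} {Z : Subcomplex X}

/-- Squashing the preimages of a simply connected subcomplex, as an isomorphism of lattices of
intermediate coverings. -/
theorem exists_excision (hY : Y.Connected) (hf : f.IsCovering) (huv : f.onV u = v)
    (hZ : Z.SimplyConnected) :
    ∃ Φ : CoverLattice f u v ≃o
        CoverLattice (Subcomplex.collapseHom f Z (Z.comap f) rfl) ((Z.comap f).projV u) (Z.projV v),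
      ∀ I : Intermediate f u v, Φ I.cls = (I.excise hZ hf).cls := by
  let Φ : CoverLattice f u v →
      CoverLattice (Subcomplex.collapseHom f Z (Z.comap f) rfl) ((Z.comap f).projV u) (Z.projV v) :=
    Quotient.lift (fun I => (I.excise hZ hf).cls) fun I J h => by
      have h := Intermediate.equivalent_iff.1 h
      exact Intermediate.cls_eq_iff.2 (le_antisymm
        ((Intermediate.ker_excise_le_iff hZ hf).2 h.le)
        ((Intermediate.ker_excise_le_iff hZ hf).2 h.ge))
  have hle : ∀ {a b}, Φ a ≤ Φ b ↔ a ≤ b := by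
    intro a b
    obtain ⟨I, rfl⟩ := Intermediate.exists_cls_eq a
    obtain ⟨J, rfl⟩ := Intermediate.exists_cls_eq b
    exact Intermediate.cls_le_iff.trans ((Intermediate.ker_excise_le_iff hZ hf).trans
      Intermediate.cls_le_iff.symm)
  have hb : Function.Bijective Φ := by
    constructor
    · intro a b h
      obtain ⟨I, rfl⟩ := Intermediate.exists_cls_eq a
      obtain ⟨J, rfl⟩ := Intermediate.exists_cls_eq b
      have h : (I.excise hZ hf).ker = (J.excise hZ hf).ker := Intermediate.cls_eq_iff.1 h
      exact Intermediate.cls_eq_iff.2 (le_antisymm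
        ((Intermediate.ker_excise_le_iff hZ hf).1 h.le)
        ((Intermediate.ker_excise_le_iff hZ hf).1 h.ge))
    · intro b
      obtain ⟨K, rfl⟩ := Intermediate.exists_cls_eq b
      obtain ⟨I, hI⟩ := Intermediate.exists_ker_excise_eq hZ hf hY huv K
      exact ⟨I.cls, Intermediate.cls_eq_iff.2 hI⟩
  exact ⟨{ Equiv.ofBijective Φ hb with map_rel_iff' := hle }, fun I => rfl⟩

end CoverLattice

end TwoComplex

theorem mainTheorem9 {X Y : TwoComplex.{u}} (hX : X.Connected) (hY : Y.Connected)
    (f : Hom Y X) (hf : f.IsCovering) (u : Y.V) (v : X.V) (huv : f.onV u = v)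
    (Z : Subcomplex X) (hZv : v ∈ Z.V) (hZc : Z.Connected) (hZs : Z.SimplyConnected) :
    ∃ f' : Hom (Z.comap f).collapse Z.collapse,
      IsInduced Z (Z.comap f) f f' ∧ f'.IsCovering ∧
      Z.collapse.Connected ∧ (Z.comap f).collapse.Connected ∧
      f'.onV ((Z.comap f).projV u) = Z.projV v ∧
      IsLatticeOrder (CoverLattice f u v) ∧
      IsLatticeOrder (CoverLattice f' ((Z.comap f).projV u) (Z.projV v)) ∧
      ∃ Φ : CoverLattice f u v ≃o CoverLattice f' ((Z.comap f).projV u) (Z.projV v),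
        ∀ I : Intermediate f u v,
          ∃ (g' : Hom (Z.comap f).collapse (Z.comap I.h).collapse)
            (h' : Hom (Z.comap I.h).collapse Z.collapse),
            IsInduced (Z.comap I.h) (Z.comap f) I.g g' ∧
            IsInduced Z (Z.comap I.h) I.h h' ∧
            (∃ (conn : (Z.comap I.h).collapse.Connected)
              (g_cov : g'.IsCovering) (h_cov : h'.IsCovering) (comp_eq : h'.comp g' = f')
              (g_pt : g'.onV ((Z.comap f).projV u) = (Z.comap I.h).projV I.pt)
              (h_pt : h'.onV ((Z.comap I.h).projV I.pt) = Z.projV v),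
              Φ I.cls = Intermediate.cls
                { W := (Z.comap I.h).collapse, conn := conn, pt := (Z.comap I.h).projV I.pt,
                  g := g', h := h', g_cov := g_cov, h_cov := h_cov, comp_eq := comp_eq,
                  g_pt := g_pt, h_pt := h_pt }) ∧
            (I.h.IsGalois v ↔ h'.IsGalois (Z.projV v)) := by
  have hY' := (Z.comap f).connected_collapse hY
  have hc := hZs.isCovering_collapseHom hf (B := Z.comap f) rfl
  have hpt : (Subcomplex.collapseHom f Z (Z.comap f) rfl).onV ((Z.comap f).projV u) = Z.projV v :=
    congrArg Z.projV huv
  obtain ⟨Φ, hΦ⟩ := CoverLattice.exists_excision hY hf huv hZs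
  refine ⟨Subcomplex.collapseHom f Z (Z.comap f) rfl, Subcomplex.isInduced_collapseHom rfl, hc,
    Z.connected_collapse hX, hY', hpt, isLatticeOrder_coverLattice hY hf huv,
    isLatticeOrder_coverLattice hY' hc hpt, Φ, fun I => ?_⟩
  exact ⟨_, _, Subcomplex.isInduced_collapseHom (I.comap_comap Z),
    Subcomplex.isInduced_collapseHom rfl,
    ⟨(I.excise hZs hf).conn, (I.excise hZs hf).g_cov, (I.excise hZs hf).h_cov,
      (I.excise hZs hf).comp_eq, (I.excise hZs hf).g_pt, (I.excise hZs hf).h_pt, hΦ I⟩,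
    hZs.isGalois_collapseHom_iff I.h_cov rfl v⟩
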